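/- A group $G$ is of F-type if it admits a presentation \[G=\langle a_1,\dots,a_n\mid a_1^{e_1}=\dots=a_n^{e_n}=U(a_1,\dots,a_p)\,V(a_{p+1},\dots,a_n)=1\rangle,\] where $n\ge 2$, $1\le p\le n-1$, each $e_i$ is $0$ or at least $2$, and, with \[G_1=\langle a_1,\dots,a_p\mid a_1^{e_1}=\dots=a_p^{e_p}=1\rangle,\qquad G_2=\langle a_{p+1},\dots,a_n\mid a_{p+1}^{e_{p+1}}=\dots=a_n^{e_n}=1\rangle\] (free products of cyclic groups), $U$ is a cyclically reduced word in the free product $G_1$ representing an element of infinite order, and $V$ is a cyclically reduced word in the free product $G_2$ representing an element of infinite order; moreover, if $p=1$ then $U=a_1^m$ with $|m|\ge 2$, and if $p=n-1$ then $V=a_n^m$ with $|m|\ge 2$. Let $G$ be a group of F-type, given with such a presentation. Then there is a homomorphism $\rho\colon G\to \mathrm{PSL}(2,\mathbb{C})$ whose compositions with the canonical homomorphisms $G_1\to G$ and $G_2\to G$ (sending each generator $a_i$ to $a_i$) are both injective; that is, $G_1$ and $G_2$ embed in $G$ and $\rho|_{G_1}$ and $\rho|_{G_2}$ are faithful. If,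 further, $U$ is not a proper power in $G_1$ and $V$ is not a proper power in $G_2$ (that is, $U\ne W^k$ for all $W\in G_1$ and $k\ge 2$, and similarly for $V$ in $G_2$), then there is an injective homomorphism $G\to \mathrm{PSL}(2,\mathbb{C})$. -/

import Mathlib

open scoped MatrixGroups

/-- The free product of cyclic groups `⟨aᵢ (i ∈ ι) ∣ aᵢ ^ eᵢ = 1⟩`; the `i`-th factor is infinite
cyclic when `e i = 0` and has order `e i` when `e i ≥ 1`. -/
abbrev CyclicFreeProduct {ι : Type} (e : ι → ℕ) : Type :=
  PresentedGroup (Set.range fun i : ι => FreeGroup.of i ^ e i)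

/-- A list of syllables `(i₁, k₁), …, (iᵣ, kᵣ)` is read as the word `a_{i₁}^{k₁} ⋯ a_{iᵣ}^{kᵣ}`. -/
def wordValue {ι : Type} (w : List (ι × ℤ)) : FreeGroup ι :=
  (w.map fun s => FreeGroup.of s.1 ^ s.2).prod

/-- The element of the free product of cyclics that a word represents. -/
def wordElt {ι : Type} (e : ι → ℕ) (w : List (ι × ℤ)) : CyclicFreeProduct e :=
  PresentedGroup.mk _ (wordValue w)

/-- A word is cyclically reduced in the free product of the cyclic groups `⟨aᵢ ∣ aᵢ ^ eᵢ⟩`: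
every syllable is nontrivial in its factor, consecutive syllables lie in different factors, and,
if there are at least two syllables, the first and the last lie in different factors. -/
def IsCyclicallyReducedWord {ι : Type} (e : ι → ℕ) (w : List (ι × ℤ)) : Prop :=
  (∀ s ∈ w, ¬ (e s.1 : ℤ) ∣ s.2) ∧
  w.IsChain (fun s t => s.1 ≠ t.1) ∧
  (2 ≤ w.length → w.head?.map Prod.fst ≠ w.getLast?.map Prod.fst)

/-- `g` is a proper power in `H`: `g = h ^ k` for some `h ∈ H` and some `k ≥ 2`. -/
def IsProperPower {H : Type*} [Group H] (g : H) : Prop :=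
  ∃ (h : H) (k : ℕ), 2 ≤ k ∧ h ^ k = g

/-- The data of an F-type presentation
`⟨a₁, …, aₙ ∣ a₁ ^ e₁ = ⋯ = aₙ ^ eₙ = U(a₁, …, a_p) V(a_{p+1}, …, aₙ) = 1⟩`.
Here `q = n - p`, the generators `a₁, …, a_p` (with exponents `e`) are indexed by `Fin p`, and
`a_{p+1}, …, aₙ` (with exponents `f`) by `Fin q`. -/
structure FTypePresentation where
  p : ℕ
  q : ℕ
  one_le_p : 1 ≤ p
  one_le_q : 1 ≤ q
  e : Fin p → ℕ
  f : Fin q → ℕ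
  e_cond : ∀ i, e i = 0 ∨ 2 ≤ e i
  f_cond : ∀ j, f j = 0 ∨ 2 ≤ f j
  U : List (Fin p × ℤ)
  V : List (Fin q × ℤ)
  U_reduced : IsCyclicallyReducedWord e U
  V_reduced : IsCyclicallyReducedWord f V
  U_infinite_order : ¬ IsOfFinOrder (wordElt e U)
  V_infinite_order : ¬ IsOfFinOrder (wordElt f V)
  U_of_p_eq_one : p = 1 → ∃ (i : Fin p) (m : ℤ), 2 ≤ |m| ∧ U = [(i, m)]
  V_of_q_eq_one : q = 1 → ∃ (j : Fin q) (m : ℤ), 2 ≤ |m| ∧ V = [(j, m)]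

namespace FTypePresentation

/-- The factor `G₁ = ⟨a₁, …, a_p ∣ a₁ ^ e₁ = ⋯ = a_p ^ e_p = 1⟩`. -/
abbrev G₁ (P : FTypePresentation) : Type := CyclicFreeProduct P.e

/-- The factor `G₂ = ⟨a_{p+1}, …, aₙ ∣ a_{p+1} ^ e_{p+1} = ⋯ = aₙ ^ eₙ = 1⟩`. -/
abbrev G₂ (P : FTypePresentation) : Type := CyclicFreeProduct P.f

/-- The relators `aᵢ ^ eᵢ` and `U V`. -/
def rels (P : FTypePresentation) : Set (FreeGroup (Fin P.p ⊕ Fin P.q)) :=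
  (Set.range fun i => FreeGroup.of i ^ Sum.elim P.e P.f i) ∪
    {FreeGroup.map Sum.inl (wordValue P.U) * FreeGroup.map Sum.inr (wordValue P.V)}

/-- The presented group. -/
abbrev Grp (P : FTypePresentation) : Type := PresentedGroup P.rels

/-- The canonical homomorphism `G₁ → G`, sending generators to generators. -/
def incl₁ (P : FTypePresentation) : P.G₁ →* P.Grp :=
  PresentedGroup.map (FreeGroup.map Sum.inl) (by
    rintro _ ⟨i, rfl⟩
    exact Or.inl ⟨Sum.inl i, by simp⟩)

/-- The canonical homomorphism `G₂ → G`, sending generators to generators. -/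
def incl₂ (P : FTypePresentation) : P.G₂ →* P.Grp :=
  PresentedGroup.map (FreeGroup.map Sum.inr) (by
    rintro _ ⟨j, rfl⟩
    exact Or.inl ⟨Sum.inr j, by simp⟩)

end FTypePresentation

/-!
`G` is the quotient of `G₁ ∗ G₂` by the single relator `U V`, so a representation of `G` is a pair
of representations `σ₁`, `σ₂` of the factors with `σ₁ U = σ₂ V⁻¹`. Letting each generator of a free
product of cyclic groups act with the fixed points `x + X⁻¹` and `x` on the projective line, for
distinct parameters `x` and prescribed eigenvalues, gives a representation over `K[X]`: a cyclically
reduced word of length at least two has a trace of positive degree, so no nontrivial element has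
squared trace `4`. Over an uncountable algebraically closed field, all but countably many
specializations of `X` (or of an eigenvalue, if `U` is conjugate into a factor) keep this property,
and all but countably many values occur as the squared trace of `σ₁ U`; likewise for `σ₂ V`.
Choosing a common value and conjugating both images into diagonal form yields `σ₁ U = σ₂ V⁻¹` with
`σ₁`, `σ₂` faithful.

There remains the freedom of conjugating `σ₂` by a diagonal matrix `diag(s, s⁻¹)`. If neither `U`
nor `V` is a proper power, their centralizers are the cyclic groups they generate, and an element of
`G` not conjugate into a factor is conjugate to an alternating product of syllables outside these
centralizers. The absence of squared trace `4` forces the off-diagonal entries of such syllables to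
be nonzero, so such a product is, up to a power of `s`, a matrix of polynomials in `s` that is
central for finitely many `s` only. A generic `s` therefore gives a faithful representation.
-/

open Polynomial

section ProjectiveSpecialLinear

variable {R S : Type*} [CommRing R] [CommRing S]

theorem trace_sq_eq_of_inv_mul_mem_center {M N : SL(2, R)}
    (h : M⁻¹ * N ∈ Subgroup.center SL(2, R)) : M.1.trace ^ 2 = N.1.trace ^ 2 := by
  obtain ⟨r, hr, hrMN⟩ := Matrix.SpecialLinearGroup.mem_center_iff.1 h
  have hN : N.1 = r • M.1 := by
    rw [← mul_inv_cancel_left M N, Matrix.SpecialLinearGroup.coe_mul, ← hrMN,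
      Matrix.scalar_apply, ← Matrix.smul_one_eq_diagonal, Matrix.mul_smul, mul_one]
  rw [Fintype.card_fin] at hr
  rw [hN, Matrix.trace_smul, smul_eq_mul, mul_pow, hr, one_mul]

/-- The square of the trace, which is the natural substitute in `PSL(2, R)` for the trace itself. -/
def traceSq : PSL(2, R) → R :=
  Quotient.lift (fun M => M.1.trace ^ 2) fun _ _ h =>
    trace_sq_eq_of_inv_mul_mem_center (QuotientGroup.leftRel_apply.1 h)

@[simp] theorem traceSq_mk (M : SL(2, R)) : traceSq (M : PSL(2, R)) = M.1.trace ^ 2 := rfl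

@[simp] theorem traceSq_one : traceSq (1 : PSL(2, R)) = 4 := by
  rw [← QuotientGroup.mk_one, traceSq_mk, Matrix.SpecialLinearGroup.coe_one, Matrix.trace_one,
    Fintype.card_fin]
  norm_num

theorem traceSq_eq_of_isConj {g h : PSL(2, R)} (hgh : IsConj g h) : traceSq g = traceSq h := by
  obtain ⟨c, rfl⟩ := isConj_iff.1 hgh
  induction g using QuotientGroup.induction_on with | _ M
  induction c using QuotientGroup.induction_on with | _ C
  rw [← QuotientGroup.mk_inv, ← QuotientGroup.mk_mul, ← QuotientGroup.mk_mul, traceSq_mk,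
    traceSq_mk, Matrix.SpecialLinearGroup.coe_mul, Matrix.trace_mul_comm,
    ← Matrix.SpecialLinearGroup.coe_mul, ← mul_assoc, inv_mul_cancel, one_mul]

theorem mem_center_SL_two_iff [IsDomain R] {M : SL(2, R)} :
    M ∈ Subgroup.center SL(2, R) ↔ M = 1 ∨ M = -1 := by
  rw [Matrix.SpecialLinearGroup.mem_center_iff]
  constructor
  · rintro ⟨r, hr, hrM⟩
    rw [Fintype.card_fin, sq_eq_one_iff] at hr
    refine hr.imp ?_ ?_ <;> rintro rfl <;> refine Subtype.ext (hrM.symm.trans ?_)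
    · exact map_one _
    · rw [map_neg, map_one, Matrix.SpecialLinearGroup.coe_neg, Matrix.SpecialLinearGroup.coe_one]
  · rintro (rfl | rfl)
    · exact ⟨1, by simp, by simp⟩
    · exact ⟨-1, by simp, by rw [map_neg, map_one]; rfl⟩

theorem psl_mk_eq_mk_iff [IsDomain R] {M N : SL(2, R)} :
    (M : PSL(2, R)) = N ↔ N = M ∨ N = -M := by
  rw [QuotientGroup.eq, mem_center_SL_two_iff, inv_mul_eq_iff_eq_mul, inv_mul_eq_iff_eq_mul,
    mul_one, mul_neg_one]

/-- Functoriality of `PSL(2, R)` in the ring `R`. -/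
def pslMap (f : R →+* S) : PSL(2, R) →* PSL(2, S) :=
  QuotientGroup.map _ _ (Matrix.SpecialLinearGroup.map f) fun M hM => by
    obtain ⟨r, hr, hrM⟩ := Matrix.SpecialLinearGroup.mem_center_iff.1 hM
    refine Matrix.SpecialLinearGroup.mem_center_iff.2 ⟨f r, by rw [← map_pow, hr, map_one], ?_⟩
    ext i j
    simp [← hrM, Matrix.diagonal_apply, apply_ite f]

theorem traceSq_pslMap (f : R →+* S) (g : PSL(2, R)) : traceSq (pslMap f g) = f (traceSq g) := by
  induction g using QuotientGroup.induction_on with | _ M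
  change (M.1.map f).trace ^ 2 = f (M.1.trace ^ 2)
  rw [map_pow, AddMonoidHom.map_trace]

end ProjectiveSpecialLinear

section SplitTorus

variable {R : Type*} [CommRing R] {P : Matrix (Fin 2) (Fin 2) R}

theorem isIdempotentElem_of_trace_eq_one (ht : P.trace = 1) (hd : P.det = 0) :
    IsIdempotentElem P := by
  rw [Matrix.trace_fin_two] at ht
  rw [Matrix.det_fin_two] at hd
  ext i j
  rw [Matrix.mul_apply, Fin.sum_univ_two]
  fin_cases i <;> fin_cases j <;> dsimp
  · linear_combination P 0 0 * ht - hd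
  · linear_combination P 0 1 * ht
  · linear_combination P 1 0 * ht
  · linear_combination P 1 1 * ht - hd

/-- The matrices acting by a unit `u` on the image and by `u⁻¹` on the kernel of the rank one
idempotent `P`. -/
def splitTorus (P : Matrix (Fin 2) (Fin 2) R) (ht : P.trace = 1) (hd : P.det = 0) :
    Rˣ →* SL(2, R) where
  toFun u := ⟨(u : R) • P + (↑u⁻¹ : R) • (1 - P), by
    have h11 : P 1 1 = 1 - P 0 0 := eq_sub_of_add_eq' (P.trace_fin_two ▸ ht)
    rw [Matrix.det_fin_two, h11] at hd
    simp only [Matrix.det_fin_two, Matrix.add_apply, Matrix.smul_apply, Matrix.sub_apply,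
      Matrix.one_apply_eq, Matrix.one_apply_ne zero_ne_one, Matrix.one_apply_ne one_ne_zero,
      smul_eq_mul, h11]
    linear_combination (u - (↑u⁻¹ : R)) ^ 2 * hd + u.mul_inv⟩
  map_one' := Subtype.ext (by simp)
  map_mul' u v := Subtype.ext (by
    have hP := isIdempotentElem_of_trace_eq_one ht hd
    change _ = ((u : R) • P + (↑u⁻¹ : R) • (1 - P)) * ((v : R) • P + (↑v⁻¹ : R) • (1 - P))
    simp only [add_mul, mul_add, Matrix.smul_mul,
      Matrix.mul_smul, hP.eq, hP.one_sub.eq, hP.mul_one_sub_self, hP.one_sub_mul_self, smul_zero,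
      add_zero, zero_add, smul_smul, Units.val_mul, mul_inv, mul_comm])

variable (ht : P.trace = 1) (hd : P.det = 0)

theorem coe_splitTorus (u : Rˣ) :
    (splitTorus P ht hd u).1 = (u : R) • P + (↑u⁻¹ : R) • (1 - P) := rfl

theorem trace_splitTorus (u : Rˣ) : (splitTorus P ht hd u).1.trace = u + ↑u⁻¹ := by
  simp only [coe_splitTorus, Matrix.trace_add, Matrix.trace_smul, Matrix.trace_sub, ht,
    Matrix.trace_one, Fintype.card_fin, smul_eq_mul]
  push_cast
  ring

theorem splitTorus_mem_center {u : Rˣ} (hu : u ^ 2 = 1) :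
    splitTorus P ht hd u ∈ Subgroup.center SL(2, R) := by
  have hinv : u⁻¹ = u := inv_eq_of_mul_eq_one_left (by rw [← sq, hu])
  refine Matrix.SpecialLinearGroup.mem_center_iff.2
    ⟨u, by rw [Fintype.card_fin, ← Units.val_pow_eq_pow_val, hu, Units.val_one], ?_⟩
  rw [coe_splitTorus, hinv, ← smul_add, add_sub_cancel, Matrix.scalar_apply,
    Matrix.smul_one_eq_diagonal]

end SplitTorus

section LeadingCoefficients

variable {R n : Type*} [CommRing R]

/-- The entries of `M` have degree at most `d`, and `L` is the matrix of their coefficients of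
degree `d`. -/
def HasLead (M : Matrix n n R[X]) (d : ℕ) (L : Matrix n n R) : Prop :=
  ∀ i j, (M i j).natDegree ≤ d ∧ (M i j).coeff d = L i j

theorem hasLead_X_smul_map_add (L N : Matrix n n R) :
    HasLead ((X : R[X]) • L.map C + N.map C) 1 L := by
  intro i j
  simp only [Matrix.add_apply, Matrix.smul_apply, Matrix.map_apply, smul_eq_mul]
  exact ⟨by compute_degree, by simp⟩

theorem HasLead.mul [Fintype n] {M M' : Matrix n n R[X]} {d d' : ℕ} {L L' : Matrix n n R}
    (h : HasLead M d L) (h' : HasLead M' d' L') : HasLead (M * M') (d + d') (L * L') := by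
  intro i j
  simp only [Matrix.mul_apply]
  constructor
  · exact natDegree_sum_le_of_forall_le _ _ fun k _ => natDegree_mul_le_of_le (h i k).1 (h' k j).1
  · rw [finsetSum_coeff]
    refine Finset.sum_congr rfl fun k _ => ?_
    rw [coeff_mul_add_eq_of_natDegree_le (h i k).1 (h' k j).1, (h i k).2, (h' k j).2]

theorem HasLead.neg {M : Matrix n n R[X]} {d : ℕ} {L : Matrix n n R} (h : HasLead M d L) :
    HasLead (-M) d (-L) := by
  intro i j
  simpa only [Matrix.neg_apply, natDegree_neg, coeff_neg, neg_inj] using h i j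

theorem HasLead.unique {M : Matrix n n R[X]} {d : ℕ} {L L' : Matrix n n R}
    (h : HasLead M d L) (h' : HasLead M d L') : L = L' := by
  ext i j
  rw [← (h i j).2, (h' i j).2]

theorem HasLead.natDegree_trace {M : Matrix (Fin 2) (Fin 2) R[X]} {d : ℕ}
    {L : Matrix (Fin 2) (Fin 2) R} (h : HasLead M d L) (hL : L.trace ≠ 0) :
    M.trace.natDegree = d := by
  rw [Matrix.trace_fin_two] at *
  refine natDegree_eq_of_le_of_coeff_ne_zero
    (natDegree_add_le_of_degree_le (h 0 0).1 (h 1 1).1) ?_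
  rwa [coeff_add, (h 0 0).2, (h 1 1).2]

theorem HasLead.eq_or_eq_neg [IsDomain R] {M M' : SL(2, R[X])} {d : ℕ}
    {L L' : Matrix (Fin 2) (Fin 2) R} (h : HasLead M.1 d L) (h' : HasLead M'.1 d L')
    (hMM' : (M : PSL(2, R[X])) = M') : L' = L ∨ L' = -L := by
  rcases psl_mk_eq_mk_iff.1 hMM' with rfl | rfl
  · exact Or.inl (h'.unique h)
  · exact Or.inr (h'.unique h.neg)

/-- The rank one matrix `(x, 1)ᵀ (1, -y)`. -/
def rankOne (x y : R) : Matrix (Fin 2) (Fin 2) R := !![x, -(x * y); 1, -y]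

theorem rankOne_mul (x y x' y' : R) : rankOne x y * rankOne x' y' = (x' - y) • rankOne x y' := by
  ext i j
  fin_cases i <;> fin_cases j <;> simp [rankOne, Matrix.mul_apply, Fin.sum_univ_two] <;> ring

theorem trace_rankOne (x y : R) : (rankOne x y).trace = x - y := by
  simp [rankOne, Matrix.trace_fin_two, sub_eq_add_neg]

theorem eq_of_smul_rankOne_eq [IsDomain R] {a b x y x' y' : R} (ha : a ≠ 0)
    (h : a • rankOne x y = b • rankOne x' y') : x = x' := by
  have h0 : a * x = b * x' := congrFun (congrFun h 0) 0
  have h1 : a * 1 = b * 1 := congrFun (congrFun h 1) 0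
  rw [mul_one, mul_one] at h1
  exact mul_left_cancel₀ ha (h1 ▸ h0)

end LeadingCoefficients

section PolynomialTorus

variable {R : Type*} [CommRing R]

/-- The idempotent with image `x + X⁻¹` and kernel `x` on the projective line over the rational
functions. -/
noncomputable def polyIdempotent (x : R) : Matrix (Fin 2) (Fin 2) R[X] :=
  !![X * C x + 1, -(X * C (x * x) + C x); X, -(X * C x)]

theorem trace_polyIdempotent (x : R) : (polyIdempotent x).trace = 1 := by
  rw [polyIdempotent, Matrix.trace_fin_two_of]
  ring

theorem det_polyIdempotent (x : R) : (polyIdempotent x).det = 0 := by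
  rw [polyIdempotent, Matrix.det_fin_two_of, C_mul]
  ring

/-- The torus over `R[X]` with eigenvalue parameters in `Rˣ` and fixed points `x` and `x + X⁻¹`. -/
noncomputable def polyTorus (x : R) : Rˣ →* SL(2, R[X]) :=
  (splitTorus _ (trace_polyIdempotent x) (det_polyIdempotent x)).comp (Units.map C.toMonoidHom)

theorem trace_polyTorus (x : R) (u : Rˣ) : (polyTorus x u).1.trace = C (u + ↑u⁻¹ : R) :=
  (trace_splitTorus (trace_polyIdempotent x) (det_polyIdempotent x) _).trans C_add.symm

theorem polyTorus_mem_center (x : R) {u : Rˣ} (hu : u ^ 2 = 1) :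
    polyTorus x u ∈ Subgroup.center SL(2, R[X]) :=
  splitTorus_mem_center (trace_polyIdempotent x) (det_polyIdempotent x)
    (by rw [← map_pow, hu, map_one])

theorem hasLead_polyTorus (x : R) (u : Rˣ) :
    HasLead (polyTorus x u).1 1 ((u - ↑u⁻¹ : R) • rankOne x x) := by
  have hM : (polyTorus x u).1 = (X : R[X]) • ((u - ↑u⁻¹ : R) • rankOne x x).map C +
      (!![(u : R), (↑u⁻¹ - u) * x; 0, ↑u⁻¹]).map C := by
    change C (u : R) • polyIdempotent x + C (↑u⁻¹ : R) • (1 - polyIdempotent x) = _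
    ext1 i j
    fin_cases i <;> fin_cases j <;> simp [polyIdempotent, rankOne] <;> ring
  exact hM ▸ hasLead_X_smul_map_add _ _

end PolynomialTorus

section Words

variable {ι : Type} {e : ι → ℕ}

/-- A word with nontrivial syllables, consecutive ones lying in different factors: the normal form
of an element of the free product. -/
def IsReducedWord (e : ι → ℕ) (w : List (ι × ℤ)) : Prop :=
  (∀ s ∈ w, ¬ (e s.1 : ℤ) ∣ s.2) ∧ w.IsChain fun s t => s.1 ≠ t.1

theorem wordValue_append (v w : List (ι × ℤ)) :
    wordValue (v ++ w) = wordValue v * wordValue w := by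
  rw [wordValue, List.map_append, List.prod_append, wordValue, wordValue]

theorem exists_wordValue_eq (g : FreeGroup ι) : ∃ w, wordValue w = g := by
  induction g using FreeGroup.induction_on with
  | C1 => exact ⟨[], rfl⟩
  | of i => exact ⟨[(i, 1)], by simp [wordValue]⟩
  | inv_of i _ => exact ⟨[(i, -1)], by simp [wordValue]⟩
  | mul x y hx hy =>
    obtain ⟨v, rfl⟩ := hx
    obtain ⟨w, rfl⟩ := hy
    exact ⟨v ++ w, wordValue_append v w⟩

theorem exists_wordElt_eq (g : CyclicFreeProduct e) : ∃ w, wordElt e w = g := by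
  obtain ⟨h, rfl⟩ := PresentedGroup.mk_surjective _ g
  obtain ⟨w, rfl⟩ := exists_wordValue_eq h
  exact ⟨w, rfl⟩

theorem wordElt_append (e : ι → ℕ) (v w : List (ι × ℤ)) :
    wordElt e (v ++ w) = wordElt e v * wordElt e w := by
  rw [wordElt, wordValue_append, map_mul, wordElt, wordElt]

theorem wordElt_cons (e : ι → ℕ) (s : ι × ℤ) (w : List (ι × ℤ)) :
    wordElt e (s :: w) = wordElt e [s] * wordElt e w :=
  wordElt_append e [s] w

theorem wordElt_singleton (e : ι → ℕ) (i : ι) (k : ℤ) :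
    wordElt e [(i, k)] = (PresentedGroup.of i : CyclicFreeProduct e) ^ k := by
  simp [wordElt, wordValue, PresentedGroup.of]

theorem of_zpow_eq_one {i : ι} {k : ℤ} (h : (e i : ℤ) ∣ k) :
    (PresentedGroup.of i : CyclicFreeProduct e) ^ k = 1 := by
  obtain ⟨m, rfl⟩ := h
  have hrel : (PresentedGroup.of i : CyclicFreeProduct e) ^ e i = 1 :=
    (map_pow _ _ _).symm.trans (PresentedGroup.one_of_mem ⟨i, rfl⟩)
  rw [zpow_mul, zpow_natCast, hrel, one_zpow]

theorem exists_shorter_of_not_isReducedWord {w : List (ι × ℤ)} (hw : ¬ IsReducedWord e w) :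
    ∃ v, v.length < w.length ∧ wordElt e v = wordElt e w := by
  rw [IsReducedWord, not_and_or] at hw
  rcases hw with hw | hw
  · push Not at hw
    obtain ⟨⟨i, k⟩, hs, hk⟩ := hw
    obtain ⟨a, b, rfl⟩ := List.append_of_mem hs
    refine ⟨a ++ b, by simp, ?_⟩
    rw [wordElt_append, wordElt_append, wordElt_cons, wordElt_singleton, of_zpow_eq_one hk, one_mul]
  · rw [List.isChain_iff_forall_rel_of_append_cons_cons] at hw
    push Not at hw
    obtain ⟨⟨i, k⟩, ⟨j, m⟩, a, b, rfl, h⟩ := hw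
    obtain rfl : i = j := h
    refine ⟨a ++ (i, k + m) :: b, by simp, ?_⟩
    rw [wordElt_append, wordElt_append, wordElt_cons, wordElt_cons e (i, k), wordElt_cons e (i, m)]
    simp only [wordElt_singleton, zpow_add, mul_assoc]

theorem exists_isReducedWord (g : CyclicFreeProduct e) :
    ∃ w, IsReducedWord e w ∧ wordElt e w = g := by
  obtain ⟨w, hw, hmin⟩ := exists_minimalFor_of_wellFoundedLT
    (fun w : List (ι × ℤ) => wordElt e w = g) List.length (exists_wordElt_eq g)
  refine ⟨w, ?_, hw⟩
  by_contra h
  obtain ⟨v, hv, hvw⟩ := exists_shorter_of_not_isReducedWord h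
  exact hv.not_ge (hmin (hvw.trans hw) hv.le)

theorem isConj_wordElt_cons_append (i : ι) (k m : ℤ) (u : List (ι × ℤ)) :
    IsConj (wordElt e ((i, m + k) :: u)) (wordElt e ((i, k) :: (u ++ [(i, m)]))) := by
  refine isConj_iff.2 ⟨(wordElt e [(i, m)])⁻¹, ?_⟩
  rw [wordElt_cons e (i, m + k), wordElt_cons e (i, k), wordElt_append]
  simp only [wordElt_singleton, zpow_add]
  group

theorem exists_shorter_isConj_of_not_isCyclicallyReducedWord {w : List (ι × ℤ)}
    (hw : ¬ IsCyclicallyReducedWord e w) :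
    ∃ v, v.length < w.length ∧ IsConj (wordElt e v) (wordElt e w) := by
  by_cases hred : IsReducedWord e w
  · obtain ⟨hlen, hends⟩ : 2 ≤ w.length ∧ w.head?.map Prod.fst = w.getLast?.map Prod.fst := by
      by_contra h
      exact hw ⟨hred.1, hred.2, fun hlen hends => h ⟨hlen, hends⟩⟩
    match w with
    | [] | [_] => simp at hlen
    | (i, k) :: t :: ts =>
      obtain ⟨u, ⟨j, m⟩, hu⟩ := List.eq_nil_or_concat' (t :: ts) |>.resolve_left (by simp)
      rw [hu, List.head?_cons, ← List.cons_append, List.getLast?_concat] at hends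
      obtain rfl : i = j := by simpa only [Option.map_some, Option.some.injEq] using hends
      rw [hu]
      exact ⟨(i, m + k) :: u, by simp, isConj_wordElt_cons_append i k m u⟩
  · obtain ⟨v, hv, hvw⟩ := exists_shorter_of_not_isReducedWord hred
    exact ⟨v, hv, hvw ▸ IsConj.refl _⟩

theorem exists_isConj_isCyclicallyReducedWord (g : CyclicFreeProduct e) :
    ∃ w, IsCyclicallyReducedWord e w ∧ IsConj (wordElt e w) g := by
  obtain ⟨w, hw, hmin⟩ := exists_minimalFor_of_wellFoundedLT
    (fun w : List (ι × ℤ) => IsConj (wordElt e w) g) List.length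
    ((exists_wordElt_eq g).imp fun w hw => by rw [hw])
  refine ⟨w, ?_, hw⟩
  by_contra h
  obtain ⟨v, hv, hvw⟩ := exists_shorter_isConj_of_not_isCyclicallyReducedWord h
  exact hv.not_ge (hmin (hvw.trans hw) hv.le)

/-- Elements conjugate into one of the cyclic factors, that is, those fixing a vertex of the
Bass–Serre tree. -/
def IsElliptic (g : CyclicFreeProduct e) : Prop :=
  ∃ (i : ι) (k : ℤ), IsConj ((PresentedGroup.of i : CyclicFreeProduct e) ^ k) g

theorem IsElliptic.zpow {z : CyclicFreeProduct e} (hz : IsElliptic z) (m : ℤ) :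
    IsElliptic (z ^ m) := by
  obtain ⟨i, k, hconj⟩ := hz
  obtain ⟨c, rfl⟩ := isConj_iff.1 hconj
  exact ⟨i, k * m, isConj_iff.2 ⟨c, by rw [conj_zpow, zpow_mul]⟩⟩

theorem exists_isConj_of_not_isElliptic {g : CyclicFreeProduct e} (hg1 : g ≠ 1)
    (hg : ¬ IsElliptic g) :
    ∃ w, IsCyclicallyReducedWord e w ∧ 2 ≤ w.length ∧ IsConj (wordElt e w) g := by
  obtain ⟨w, hw, hwg⟩ := exists_isConj_isCyclicallyReducedWord g
  refine ⟨w, hw, ?_, hwg⟩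
  match w with
  | [] => exact absurd (isConj_one_right.1 hwg) hg1
  | [(i, k)] => exact absurd ⟨i, k, wordElt_singleton e i k ▸ hwg⟩ hg
  | _ :: _ :: w => simp

end Words

section PolynomialRepresentation

variable {R : Type*} [CommRing R] {ι : Type} {e : ι → ℕ}

theorem zpow_sq_eq_one_iff {H : Type*} [CommGroup H] {u : H} {n : ℕ}
    (hu : IsPrimitiveRoot u (2 * n)) (k : ℤ) : (u ^ k) ^ 2 = 1 ↔ (n : ℤ) ∣ k := by
  rw [← zpow_natCast, ← zpow_mul, hu.zpow_eq_one_iff_dvd, mul_comm k]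
  push_cast
  exact mul_dvd_mul_iff_left two_ne_zero

/-- The representation sending the `i`-th generator to the element with eigenvalue parameter `l i`
of the torus with fixed points `x i` and `x i + X⁻¹`. -/
noncomputable def polyRep (x : ι → R) (l : ι → Rˣ) (hl : ∀ i, IsPrimitiveRoot (l i) (2 * e i)) :
    CyclicFreeProduct e →* PSL(2, R[X]) :=
  PresentedGroup.toGroup (f := fun i => (polyTorus (x i) (l i) : PSL(2, R[X]))) (by
    rintro _ ⟨i, rfl⟩
    rw [map_pow, FreeGroup.lift_apply_of, ← QuotientGroup.mk_pow, ← map_pow,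
      QuotientGroup.eq_one_iff]
    refine polyTorus_mem_center _ ?_
    rw [← zpow_natCast (l i), zpow_sq_eq_one_iff (hl i)])

variable {x : ι → R} {l : ι → Rˣ} (hl : ∀ i, IsPrimitiveRoot (l i) (2 * e i))

theorem polyRep_of_zpow (i : ι) (k : ℤ) :
    polyRep x l hl (PresentedGroup.of i ^ k) = (polyTorus (x i) (l i ^ k) : PSL(2, R[X])) := by
  rw [map_zpow, polyRep, PresentedGroup.toGroup.of, ← QuotientGroup.mk_zpow, ← map_zpow]

theorem polyRep_wordElt_cons (s : ι × ℤ) (w : List (ι × ℤ)) :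
    polyRep x l hl (wordElt e (s :: w)) =
      (polyTorus (x s.1) (l s.1 ^ s.2) : PSL(2, R[X])) * polyRep x l hl (wordElt e w) := by
  rw [wordElt_cons, map_mul, ← polyRep_of_zpow hl, wordElt_singleton]

theorem traceSq_polyRep_of_isConj {g : CyclicFreeProduct e} {i : ι} {k : ℤ}
    (hg : IsConj (PresentedGroup.of i ^ k) g) :
    traceSq (polyRep x l hl g) = C ((↑(l i ^ k) + ↑(l i ^ k)⁻¹ : R) ^ 2) := by
  rw [← traceSq_eq_of_isConj ((polyRep x l hl).map_isConj hg), C_pow, ← trace_polyTorus (x i)]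
  exact congrArg traceSq (polyRep_of_zpow hl i k)

theorem sub_inv_ne_zero_of_sq_ne_one {u : Rˣ} (hu : u ^ 2 ≠ 1) : (u - ↑u⁻¹ : R) ≠ 0 := by
  rwa [sub_ne_zero, ne_eq, Units.val_inj, ← mul_eq_one_iff_eq_inv, ← sq]

variable [IsDomain R]

theorem exists_hasLead_polyRep (hx : Function.Injective x) {w : List (ι × ℤ)}
    (hw : IsReducedWord e w) {s t : ι × ℤ} (hs : s ∈ w.head?) (ht : t ∈ w.getLast?) :
    ∃ M : SL(2, R[X]), (M : PSL(2, R[X])) = polyRep x l hl (wordElt e w) ∧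
      ∃ c : R, c ≠ 0 ∧ HasLead M.1 w.length (c • rankOne (x s.1) (x t.1)) := by
  induction w generalizing s with
  | nil => simp at hs
  | cons a w ih =>
    obtain rfl : a = s := by simpa using hs
    have ha : ((l a.1 ^ a.2 : Rˣ) - ((l a.1 ^ a.2)⁻¹ : Rˣ) : R) ≠ 0 :=
      sub_inv_ne_zero_of_sq_ne_one fun h =>
        hw.1 a List.mem_cons_self ((zpow_sq_eq_one_iff (hl _) _).1 h)
    have hlead := hasLead_polyTorus (x a.1) (l a.1 ^ a.2)
    rw [polyRep_wordElt_cons]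
    rcases w with _ | ⟨b, w⟩
    · obtain rfl : a = t := by simpa using ht
      exact ⟨_, (mul_one _).symm, _, ha, hlead⟩
    · obtain ⟨M, hM, c, hc, hL⟩ := ih ⟨fun s hs => hw.1 s (List.mem_cons_of_mem _ hs), hw.2.tail⟩
        (s := b) (by simp) (by simpa using ht)
      have hab : a.1 ≠ b.1 := (List.isChain_cons_cons.1 hw.2).1
      refine ⟨_ * M, by rw [← hM, QuotientGroup.mk_mul], _,
        mul_ne_zero (mul_ne_zero ha hc) (sub_ne_zero.2 (hx.ne hab.symm)), ?_⟩
      have hmul := hlead.mul hL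
      rwa [smul_mul_smul_comm, rankOne_mul, smul_smul, add_comm] at hmul

theorem natDegree_traceSq_polyRep_wordElt (hx : Function.Injective x) {w : List (ι × ℤ)}
    (hw : IsCyclicallyReducedWord e w) (hlen : 2 ≤ w.length) :
    (traceSq (polyRep x l hl (wordElt e w))).natDegree = 2 * w.length := by
  have hne : w ≠ [] := by
    rintro rfl
    simp at hlen
  obtain ⟨M, hM, c, hc, hlead⟩ := exists_hasLead_polyRep hl hx ⟨hw.1, hw.2.1⟩
    (List.head?_eq_some_head hne) (List.getLast?_eq_some_getLast hne)
  have hends := hw.2.2 hlen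
  rw [List.head?_eq_some_head hne, List.getLast?_eq_some_getLast hne, Option.map_some,
    Option.map_some, ne_eq, Option.some_inj] at hends
  rw [← hM, traceSq_mk, natDegree_pow, hlead.natDegree_trace]
  rw [Matrix.trace_smul, trace_rankOne]
  exact smul_ne_zero hc (sub_ne_zero.2 (hx.ne hends))

theorem natDegree_traceSq_polyRep_pos (hx : Function.Injective x) {g : CyclicFreeProduct e}
    (hg1 : g ≠ 1) (hg : ¬ IsElliptic g) : 0 < (traceSq (polyRep x l hl g)).natDegree := by
  obtain ⟨w, hw, hlen, hwg⟩ := exists_isConj_of_not_isElliptic hg1 hg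
  rw [← traceSq_eq_of_isConj ((polyRep x l hl).map_isConj hwg),
    natDegree_traceSq_polyRep_wordElt hl hx hw hlen]
  omega

end PolynomialRepresentation

section UnipotentFree

variable {R : Type*} [CommRing R] {H : Type*} [Group H]

/-- No nontrivial element is sent to a unipotent one. This strengthening of faithfulness only
involves the squared traces, so it can be tested on a family of representations algebraically. -/
def IsUnipotentFree (σ : H →* PSL(2, R)) : Prop :=
  ∀ h, h ≠ 1 → traceSq (σ h) ≠ 4

theorem IsUnipotentFree.injective {σ : H →* PSL(2, R)} (hσ : IsUnipotentFree σ) :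
    Function.Injective σ := by
  refine (injective_iff_map_eq_one σ).2 fun h hh => ?_
  by_contra h1
  exact hσ h h1 (hh ▸ traceSq_one)

theorem traceSq_conj_comp (c : PSL(2, R)) (σ : H →* PSL(2, R)) (h : H) :
    traceSq ((MulAut.conj c).toMonoidHom.comp σ h) = traceSq (σ h) :=
  (traceSq_eq_of_isConj (isConj_iff.2 ⟨c, rfl⟩)).symm

theorem IsUnipotentFree.conj_comp {σ : H →* PSL(2, R)} (hσ : IsUnipotentFree σ) (c : PSL(2, R)) :
    IsUnipotentFree ((MulAut.conj c).toMonoidHom.comp σ) := fun h h1 =>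
  traceSq_conj_comp c σ h ▸ hσ h h1

theorem IsUnipotentFree.countable_specializations [IsDomain R] [Countable H]
    {σ : H →* PSL(2, R[X])} (hσ : IsUnipotentFree σ) :
    {y | ¬ IsUnipotentFree ((pslMap (evalRingHom y)).comp σ)}.Countable := by
  refine (Set.countable_iUnion fun h : {h : H // h ≠ 1} =>
    (finite_setOfPred_isRoot (sub_ne_zero.2 (hσ h h.2))).countable).mono fun y hy => ?_
  simp only [IsUnipotentFree, Set.mem_ofPred_eq, not_forall, not_not] at hy
  obtain ⟨h, h1, hy⟩ := hy
  refine Set.mem_iUnion.2 ⟨⟨h, h1⟩, ?_⟩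
  rw [MonoidHom.comp_apply, traceSq_pslMap, coe_evalRingHom] at hy
  rw [Set.mem_ofPred_eq, IsRoot.def, eval_sub, hy, eval_ofNat, sub_self]

variable [IsDomain R] {ι : Type} {e : ι → ℕ}

theorem isUnipotentFree_polyRep {x : ι → R} (hx : Function.Injective x) {l : ι → Rˣ}
    (hl : ∀ i, IsPrimitiveRoot (l i) (2 * e i)) : IsUnipotentFree (polyRep x l hl) := by
  intro g hg1 h4
  by_cases hg : IsElliptic g
  · obtain ⟨i, k, hik⟩ := hg
    rw [traceSq_polyRep_of_isConj hl hik, ← C_ofNat, C_inj] at h4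
    refine hg1 (isConj_one_right.1 ?_)
    rw [← of_zpow_eq_one (e := e) (i := i) (k := k) ?_]
    · exact hik
    rw [← zpow_sq_eq_one_iff (hl i)]
    by_contra hsq
    refine pow_ne_zero 2 (sub_inv_ne_zero_of_sq_ne_one hsq) ?_
    linear_combination h4 - 4 * (l i ^ k).mul_inv
  · refine (natDegree_traceSq_polyRep_pos hl hx hg1 hg).ne' ?_
    rw [h4, natDegree_ofNat]

end UnipotentFree

section PrescribedTrace

variable {K : Type*} [Field K]

theorem exists_notMem_of_countable {α : Type*} [Uncountable α] {s : Set α} (hs : s.Countable) :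
    ∃ x, x ∉ s :=
  (Set.ne_univ_iff_exists_notMem s).1 fun h => Set.not_countable_univ (h ▸ hs)

theorem countable_setOf_isOfFinOrder_units {R : Type*} [CommRing R] [IsDomain R] :
    {u : Rˣ | IsOfFinOrder u}.Countable := by
  refine (Set.countable_iUnion fun n : ℕ => Set.countable_coe_iff.1
    (inferInstance : Countable (rootsOfUnity (n + 1) R))).mono fun u hu => ?_
  obtain ⟨n, hn, hun⟩ := isOfFinOrder_iff_pow_eq_one.1 hu
  exact Set.mem_iUnion.2 ⟨n - 1, by rwa [Nat.sub_add_cancel hn]⟩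

variable {ι : Type} [Countable ι] {e : ι → ℕ}

instance countable_cyclicFreeProduct : Countable (CyclicFreeProduct e) :=
  (PresentedGroup.mk_surjective _).countable

theorem exists_isUnipotentFree_specialization [Uncountable K] {l : ι → Kˣ}
    (hl : ∀ i, IsPrimitiveRoot (l i) (2 * e i)) {x : ι → K} (hx : Function.Injective x) :
    ∃ y : K, IsUnipotentFree ((pslMap (evalRingHom y)).comp (polyRep x l hl)) := by
  simpa using exists_notMem_of_countable (isUnipotentFree_polyRep hx hl).countable_specializations

theorem exists_injective_of_countable (ι K : Type*) [Countable ι] [AddMonoidWithOne K]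
    [CharZero K] : ∃ x : ι → K, Function.Injective x :=
  (exists_injective_nat ι).imp' (fun x i => x i) fun _ hx => Nat.cast_injective.comp hx

variable [IsAlgClosed K]

theorem exists_units_isPrimitiveRoot [CharZero K] (n : ℕ) : ∃ u : Kˣ, IsPrimitiveRoot u n := by
  rcases eq_or_ne n 0 with rfl | hn
  · refine ⟨Units.mk0 2 two_ne_zero, IsPrimitiveRoot.iff_orderOf.2 (orderOf_eq_zero_iff.2 ?_)⟩
    rw [isOfFinOrder_iff_pow_eq_one]
    rintro ⟨m, hm, h⟩
    have h2 : ((2 ^ m : ℕ) : K) = (1 : ℕ) := by simpa [Units.ext_iff] using h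
    exact (Nat.one_lt_two_pow hm.ne').ne' (Nat.cast_injective h2)
  · have : NeZero n := ⟨hn⟩
    obtain ⟨ζ, hζ⟩ := HasEnoughRootsOfUnity.exists_primitiveRoot K n
    obtain ⟨u, rfl⟩ := hζ.isUnit hn
    exact ⟨u, IsPrimitiveRoot.coe_units_iff.1 hζ⟩

theorem exists_units_add_inv_eq (a : K) : ∃ z : Kˣ, (z + ↑z⁻¹ : K) = a := by
  obtain ⟨z, hz⟩ := IsAlgClosed.exists_root (X ^ 2 - C a * X + 1 : K[X])
    (by rw [show (X ^ 2 - C a * X + 1 : K[X]).degree = 2 by compute_degree!]; decide)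
  have hz' : z ^ 2 - a * z + 1 = 0 := by simpa using hz
  have hz0 : z ≠ 0 := by
    rintro rfl
    simp at hz'
  refine ⟨Units.mk0 z hz0, mul_left_cancel₀ hz0 ?_⟩
  rw [Units.val_inv_eq_inv_val, Units.val_mk0, mul_add, mul_inv_cancel₀ hz0]
  linear_combination hz'

theorem exists_units_add_inv_sq_eq (τ : K) : ∃ z : Kˣ, (z + ↑z⁻¹ : K) ^ 2 = τ := by
  obtain ⟨a, ha⟩ := IsAlgClosed.exists_pow_nat_eq τ two_pos
  obtain ⟨z, hz⟩ := exists_units_add_inv_eq a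
  exact ⟨z, by rw [hz, ha]⟩

theorem exists_units_pow_eq (z : Kˣ) {n : ℕ} (hn : n ≠ 0) : ∃ w : Kˣ, w ^ n = z := by
  obtain ⟨w, hw⟩ := IsAlgClosed.exists_pow_nat_eq (z : K) (Nat.pos_of_ne_zero hn)
  have hw0 : w ≠ 0 := by
    rintro rfl
    exact z.ne_zero (by rw [← hw, zero_pow hn])
  exact ⟨Units.mk0 w hw0, Units.ext (by rw [Units.val_pow_eq_pow_val, Units.val_mk0, hw])⟩

theorem exists_units_zpow_eq (z : Kˣ) {k : ℤ} (hk : k ≠ 0) : ∃ w : Kˣ, w ^ k = z := by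
  obtain ⟨n, rfl | rfl⟩ := k.eq_nat_or_neg
  · exact (exists_units_pow_eq z (by exact_mod_cast hk)).imp fun w hw => by rw [zpow_natCast, hw]
  · exact (exists_units_pow_eq z⁻¹ (by simpa using hk)).imp fun w hw => by
      rw [zpow_neg, zpow_natCast, hw, inv_inv]

variable [CharZero K]

theorem countable_exceptional_traceSq_of_not_isElliptic {u : CyclicFreeProduct e} (hu1 : u ≠ 1)
    (hu : ¬ IsElliptic u) :
    {τ : K | ∀ σ : CyclicFreeProduct e →* PSL(2, K), IsUnipotentFree σ →
      traceSq (σ u) ≠ τ}.Countable := by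
  obtain ⟨x, hx⟩ := exists_injective_of_countable ι K
  choose l hl using fun i => exists_units_isPrimitiveRoot (K := K) (2 * e i)
  set p := traceSq (polyRep x l hl u)
  have hdeg : 0 < p.natDegree := natDegree_traceSq_polyRep_pos hl hx hu1 hu
  refine ((isUnipotentFree_polyRep hx hl).countable_specializations.image (p.eval ·)).mono
    fun τ hτ => ?_
  obtain ⟨y, hy⟩ : ∃ y, p.eval y = τ := by
    obtain ⟨y, hy⟩ := IsAlgClosed.exists_root (p - C τ)
      (by rw [degree_sub_C (natDegree_pos_iff_degree_pos.1 hdeg)]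
          exact (natDegree_pos_iff_degree_pos.1 hdeg).ne')
    exact ⟨y, by simpa [sub_eq_zero] using hy⟩
  exact ⟨y, fun hfree => hτ _ hfree ((traceSq_pslMap _ _).trans hy), hy⟩

theorem countable_exceptional_traceSq_of_isElliptic [Uncountable K] {u : CyclicFreeProduct e}
    (hu : ¬ IsOfFinOrder u) (hell : IsElliptic u) :
    {τ : K | ∀ σ : CyclicFreeProduct e →* PSL(2, K), IsUnipotentFree σ →
      traceSq (σ u) ≠ τ}.Countable := by
  classical
  obtain ⟨i, k, hik⟩ := hell
  replace hu : ¬ IsOfFinOrder ((PresentedGroup.of i : CyclicFreeProduct e) ^ k) :=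
    fun h => hu (hik.isOfFinOrder h)
  have hk : k ≠ 0 := by
    rintro rfl
    exact hu (zpow_zero (PresentedGroup.of i : CyclicFreeProduct e) ▸ IsOfFinOrder.one)
  have hei : e i = 0 := by
    by_contra h0
    refine hu (IsOfFinOrder.zpow (isOfFinOrder_iff_pow_eq_one.2 ⟨e i, Nat.pos_of_ne_zero h0, ?_⟩))
    rw [← zpow_natCast]
    exact of_zpow_eq_one dvd_rfl
  obtain ⟨x, hx⟩ := exists_injective_of_countable ι K
  choose l hl using fun i => exists_units_isPrimitiveRoot (K := K) (2 * e i)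
  refine (countable_setOf_isOfFinOrder_units.image
    fun w : Kˣ => (↑(w ^ k) + ↑(w ^ k)⁻¹ : K) ^ 2).mono fun τ hτ => ?_
  obtain ⟨z, hz⟩ := exists_units_add_inv_sq_eq τ
  obtain ⟨w, rfl⟩ := exists_units_zpow_eq z hk
  refine ⟨w, ?_, hz⟩
  by_contra hw
  have hl' : ∀ j, IsPrimitiveRoot (Function.update l i w j) (2 * e j) := by
    intro j
    rcases eq_or_ne j i with rfl | hj
    · rw [Function.update_self, hei]
      exact IsPrimitiveRoot.iff_orderOf.2 (orderOf_eq_zero_iff.2 hw)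
    · rw [Function.update_of_ne hj]
      exact hl j
  obtain ⟨y, hy⟩ := exists_isUnipotentFree_specialization hl' hx
  refine hτ _ hy ?_
  rw [MonoidHom.comp_apply, traceSq_pslMap, traceSq_polyRep_of_isConj hl' hik,
    Function.update_self, coe_evalRingHom, eval_C, hz]

theorem countable_exceptional_traceSq [Uncountable K] {u : CyclicFreeProduct e}
    (hu : ¬ IsOfFinOrder u) :
    {τ : K | ∀ σ : CyclicFreeProduct e →* PSL(2, K), IsUnipotentFree σ →
      traceSq (σ u) ≠ τ}.Countable := by
  by_cases hell : IsElliptic u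
  · exact countable_exceptional_traceSq_of_isElliptic hu hell
  · refine countable_exceptional_traceSq_of_not_isElliptic ?_ hell
    rintro rfl
    exact hu IsOfFinOrder.one

end PrescribedTrace

section Traces

variable {R : Type*} [CommRing R]

theorem trace_mul_add_trace_mul_inv (A B : SL(2, R)) :
    (A * B).1.trace + (A * B⁻¹).1.trace = A.1.trace * B.1.trace := by
  have hB : B.1 + B.1.adjugate = Matrix.scalar (Fin 2) B.1.trace := by
    rw [Matrix.adjugate_fin_two, Matrix.trace_fin_two, Matrix.scalar_apply]
    ext i j
    fin_cases i <;> fin_cases j <;> simp [add_comm]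
  rw [Matrix.SpecialLinearGroup.coe_mul, Matrix.SpecialLinearGroup.coe_mul,
    Matrix.SpecialLinearGroup.coe_inv, ← Matrix.trace_add, ← mul_add]
  refine (congrArg (fun N => (A.1 * N).trace) hB).trans ?_
  rw [Matrix.scalar_apply, ← Matrix.smul_one_eq_diagonal, Matrix.mul_smul, mul_one,
    Matrix.trace_smul, smul_eq_mul, mul_comm]

theorem trace_mul_self (A : SL(2, R)) : (A * A).1.trace = A.1.trace ^ 2 - 2 := by
  have h := trace_mul_add_trace_mul_inv A A
  rw [mul_inv_cancel, Matrix.SpecialLinearGroup.coe_one, Matrix.trace_one, Fintype.card_fin] at h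
  linear_combination h

theorem trace_mul_mul_trace_mul_inv {A B : SL(2, R)} (h : Commute A B) :
    (A * B).1.trace * (A * B⁻¹).1.trace = A.1.trace ^ 2 + B.1.trace ^ 2 - 4 := by
  have hA : A * B * (A * B⁻¹) = A * A := by
    rw [h.inv_right.eq, mul_assoc, mul_inv_cancel_left]
  have hB : A * B * (A * B⁻¹)⁻¹ = B * B := by
    rw [mul_inv_rev, inv_inv, h.eq, mul_assoc, h.symm.inv_right.eq]
    group
  rw [← trace_mul_add_trace_mul_inv, hA, hB, trace_mul_self, trace_mul_self]
  ring

theorem commute_SL_two_iff {M N : SL(2, R)} : Commute M N ↔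
    M.1 0 1 * N.1 1 0 = N.1 0 1 * M.1 1 0 ∧
    M.1 0 1 * (N.1 0 0 - N.1 1 1) = N.1 0 1 * (M.1 0 0 - M.1 1 1) ∧
    M.1 1 0 * (N.1 0 0 - N.1 1 1) = N.1 1 0 * (M.1 0 0 - M.1 1 1) := by
  rw [commute_iff_eq, Matrix.SpecialLinearGroup.ext_iff]
  simp only [Fin.forall_fin_two, Matrix.SpecialLinearGroup.coe_mul, Matrix.mul_apply,
    Fin.sum_univ_two]
  constructor
  · rintro ⟨⟨h1, h2⟩, h3, -⟩
    exact ⟨by linear_combination h1, by linear_combination -h2, by linear_combination h3⟩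
  · rintro ⟨h1, h2, h3⟩
    exact ⟨⟨by linear_combination h1, by linear_combination -h2⟩, by linear_combination h3,
      by linear_combination -h1⟩

theorem trace_sq_eq_four_of_apply_zero_one_eq_zero {T : SL(2, R)} (h01 : T.1 0 1 = 0)
    (hdiag : T.1 0 0 - T.1 1 1 = 0) :
    T.1.trace ^ 2 = 4 := by
  have hd := T.det_coe
  rw [Matrix.det_fin_two, h01] at hd
  rw [Matrix.trace_fin_two]
  linear_combination (T.1 0 0 - T.1 1 1) * hdiag + 4 * hd

variable [IsDomain R]

theorem commute_of_commute_of_commute {A B T : SL(2, R)} (hT : T.1.trace ^ 2 ≠ 4)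
    (hA : Commute A T) (hB : Commute B T) : Commute A B := by
  have hT' : T.1 0 1 ≠ 0 ∨ T.1 0 0 - T.1 1 1 ≠ 0 := by
    by_contra! h
    exact hT (trace_sq_eq_four_of_apply_zero_one_eq_zero h.1 h.2)
  rw [commute_SL_two_iff] at hA hB ⊢
  obtain ⟨a1, a2, a3⟩ := hA
  obtain ⟨b1, b2, b3⟩ := hB
  rcases hT' with h | h <;> refine ⟨?_, ?_, ?_⟩ <;> apply mul_left_cancel₀ h <;> grind

theorem commute_of_commute_mk [CharZero R] {M N : SL(2, R)} (hN : N.1.trace ≠ 0)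
    (h : Commute (M : PSL(2, R)) N) : Commute M N := by
  refine (psl_mk_eq_mk_iff.1 h.eq.symm).resolve_right fun hneg => hN ?_
  have hconj : M * N * M⁻¹ = -N := by
    rw [mul_inv_eq_iff_eq_mul, neg_mul]
    exact hneg
  have htrace : N.1.trace = -N.1.trace := by
    rw [← Matrix.trace_neg, ← Matrix.SpecialLinearGroup.coe_neg, ← hconj,
      Matrix.SpecialLinearGroup.coe_mul, Matrix.trace_mul_comm, ← Matrix.SpecialLinearGroup.coe_mul,
      inv_mul_cancel_left]
  exact self_eq_neg.1 htrace

end Traces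

section EuclideanDescent

variable {R : Type*} [CommRing R] [IsDomain R]

theorem natDegree_trace_mul_lt_or {A B : SL(2, R[X])} (h : Commute A B)
    (hB : 0 < B.1.trace.natDegree) (hBA : B.1.trace.natDegree ≤ A.1.trace.natDegree) :
    (A * B).1.trace.natDegree < A.1.trace.natDegree ∨
      (A * B⁻¹).1.trace.natDegree < A.1.trace.natDegree := by
  have hadd := congrArg natDegree (trace_mul_add_trace_mul_inv A B)
  have hmul := congrArg natDegree (trace_mul_mul_trace_mul_inv h)
  by_contra! hcon
  rw [natDegree_mul (ne_zero_of_natDegree_gt (hB.trans_le hBA)) (ne_zero_of_natDegree_gt hB)]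
    at hadd
  rw [natDegree_mul (ne_zero_of_natDegree_gt (hB.trans_le (hBA.trans hcon.1)))
    (ne_zero_of_natDegree_gt (hB.trans_le (hBA.trans hcon.2)))] at hmul
  have hle := natDegree_add_le (A * B).1.trace (A * B⁻¹).1.trace
  have hsq : (A.1.trace ^ 2 + B.1.trace ^ 2 - 4).natDegree ≤ 2 * A.1.trace.natDegree := by
    rw [show (4 : R[X]) = C 4 from rfl, natDegree_sub_C]
    refine natDegree_add_le_of_degree_le ?_ ?_ <;> rw [natDegree_pow]
    omega
  omega

theorem natDegree_traceSq_mul_lt_or [CharZero R] {S T U : PSL(2, R[X])} (hS : Commute S U)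
    (hT : Commute T U) (hU : 0 < (traceSq U).natDegree) (hT0 : 0 < (traceSq T).natDegree)
    (hTS : (traceSq T).natDegree ≤ (traceSq S).natDegree) :
    (traceSq (S * T)).natDegree < (traceSq S).natDegree ∨
      (traceSq (S * T⁻¹)).natDegree < (traceSq S).natDegree := by
  induction S using QuotientGroup.induction_on with | _ A
  induction T using QuotientGroup.induction_on with | _ B
  induction U using QuotientGroup.induction_on with | _ V
  rw [← QuotientGroup.mk_mul, ← QuotientGroup.mk_inv, ← QuotientGroup.mk_mul]
  simp only [traceSq_mk] at hU ⊢
  simp only [traceSq_mk, natDegree_pow] at hT0 hTS ⊢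
  have hV : V.1.trace ≠ 0 := by
    intro hV
    simp [hV] at hU
  have hV4 : V.1.trace ^ 2 ≠ 4 := by
    intro hV4
    simp [hV4] at hU
  have hAB := commute_of_commute_of_commute hV4 (commute_of_commute_mk hV hS)
    (commute_of_commute_mk hV hT)
  refine (natDegree_trace_mul_lt_or hAB ?_ ?_).imp ?_ ?_ <;> omega

theorem isCyclic_of_euclidean_descent {H : Type*} [Group H] (d : H → ℕ)
    (hd : ∀ g h : H, g ≠ 1 → h ≠ 1 → d h ≤ d g → d (g * h) < d g ∨ d (g * h⁻¹) < d g) :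
    IsCyclic H := by
  cases subsingleton_or_nontrivial H
  · infer_instance
  obtain ⟨z, hz, hmin⟩ := exists_minimalFor_of_wellFoundedLT (fun g : H => g ≠ 1) d (exists_ne 1)
  refine ⟨z, fun g => ?_⟩
  induction hn : d g using Nat.strong_induction_on generalizing g with
  | _ n ih =>
    obtain rfl | hg := eq_or_ne g 1
    · exact one_mem (Subgroup.zpowers z)
    have hzg : d z ≤ d g := (le_total (d z) (d g)).elim id (hmin hg)
    rcases hd g z hg hz hzg with hlt | hlt
    · exact (Subgroup.mul_mem_cancel_right _ (Subgroup.mem_zpowers z)).1 (ih _ (hn ▸ hlt) _ rfl)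
    · exact (Subgroup.mul_mem_cancel_right _ (inv_mem (Subgroup.mem_zpowers z))).1
        (ih _ (hn ▸ hlt) _ rfl)

end EuclideanDescent

section Centralizers

variable {ι : Type} {e : ι → ℕ}

theorem exists_injective_isPrimitiveRoot (e : ι → ℕ) :
    ∃ (x : ι → MvPolynomial ι ℂ) (l : ι → (MvPolynomial ι ℂ)ˣ),
      Function.Injective x ∧ ∀ i, IsPrimitiveRoot (l i) (2 * e i) := by
  choose l hl using fun i => exists_units_isPrimitiveRoot (K := ℂ) (2 * e i)
  exact ⟨MvPolynomial.X, fun i => Units.map MvPolynomial.C.toMonoidHom (l i),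
    MvPolynomial.X_injective, fun i =>
      (hl i).map_of_injective (Units.map_injective (MvPolynomial.C_injective ι ℂ))⟩

theorem eq_of_commute_polyRep {R : Type*} [CommRing R] [IsDomain R] {x : ι → R} {l : ι → Rˣ}
    (hl : ∀ i, IsPrimitiveRoot (l i) (2 * e i)) (hx : Function.Injective x) {i : ι} {k : ℤ}
    (hk : ¬ (e i : ℤ) ∣ k) {s : ι × ℤ} {w : List (ι × ℤ)} (hw : IsReducedWord e (s :: w))
    (hcomm : Commute (polyRep x l hl (wordElt e (s :: w)))
      (polyRep x l hl (PresentedGroup.of i ^ k))) : s.1 = i := by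
  by_contra hs
  obtain ⟨M, hM, c, hc, hlead⟩ := exists_hasLead_polyRep hl hx hw (s := s) (by simp)
    (List.getLast?_eq_some_getLast (List.cons_ne_nil s w))
  have hT := hasLead_polyTorus (x i) (l i ^ k)
  have ha : ((l i ^ k : Rˣ) - ((l i ^ k)⁻¹ : Rˣ) : R) ≠ 0 :=
    sub_inv_ne_zero_of_sq_ne_one fun h => hk ((zpow_sq_eq_one_iff (hl i) k).1 h)
  have hTM := hT.mul hlead
  have hMT := hlead.mul hT
  rw [smul_mul_smul_comm, rankOne_mul, smul_smul,
    ← Matrix.SpecialLinearGroup.coe_mul] at hTM hMT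
  rw [add_comm] at hMT
  have hmk : ((polyTorus (x i) (l i ^ k) * M : SL(2, R[X])) : PSL(2, R[X])) =
      ((M * polyTorus (x i) (l i ^ k) : SL(2, R[X])) : PSL(2, R[X])) := by
    rw [QuotientGroup.mk_mul, QuotientGroup.mk_mul, hM, ← polyRep_of_zpow hl, hcomm.eq]
  have hcoeff := mul_ne_zero (mul_ne_zero ha hc) (sub_ne_zero.2 (hx.ne hs))
  rcases hTM.eq_or_eq_neg hMT hmk with h | h
  · exact hs (hx (eq_of_smul_rankOne_eq hcoeff h.symm).symm)
  · rw [← neg_smul] at h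
    exact hs (hx (eq_of_smul_rankOne_eq (neg_ne_zero.2 hcoeff) h.symm).symm)

theorem eq_of_commute_of_zpow {i : ι} {k : ℤ} (hk : ¬ (e i : ℤ) ∣ k) {s : ι × ℤ}
    {w : List (ι × ℤ)} (hw : IsReducedWord e (s :: w))
    (hcomm : Commute (wordElt e (s :: w)) (PresentedGroup.of i ^ k)) : s.1 = i := by
  obtain ⟨x, l, hx, hl⟩ := exists_injective_isPrimitiveRoot e
  exact eq_of_commute_polyRep hl hx hk hw (hcomm.map (polyRep x l hl))

theorem mem_zpowers_of_commute_of_zpow {i : ι} {k : ℤ} (hk : ¬ (e i : ℤ) ∣ k)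
    {g : CyclicFreeProduct e} (h : Commute g (PresentedGroup.of i ^ k)) :
    g ∈ Subgroup.zpowers (PresentedGroup.of i : CyclicFreeProduct e) := by
  obtain ⟨w, hw, rfl⟩ := exists_isReducedWord g
  match w, hw, h with
  | [], _, _ => exact one_mem _
  | (j, m) :: w, hw, h =>
    obtain rfl : j = i := eq_of_commute_of_zpow hk hw h
    rw [wordElt_cons, wordElt_singleton] at h ⊢
    match w, hw, h with
    | [], _, _ => exact mul_mem (Subgroup.zpow_mem_zpowers _ m) (one_mem _)
    | b :: w, hw, h =>
      have hcomm := ((Commute.refl (PresentedGroup.of j)).zpow_zpow m k).inv_left.mul_left h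
      rw [inv_mul_cancel_left] at hcomm
      have hbw : IsReducedWord e (b :: w) :=
        ⟨fun s hs => hw.1 s (List.mem_cons_of_mem _ hs), hw.2.tail⟩
      exact absurd (eq_of_commute_of_zpow hk hbw hcomm).symm (List.isChain_cons_cons.1 hw.2).1

theorem IsElliptic.exists_forall_commute_mem_zpowers {u : CyclicFreeProduct e} (hu1 : u ≠ 1)
    (hu : IsElliptic u) : ∃ z, IsElliptic z ∧ ∀ g, Commute g u → g ∈ Subgroup.zpowers z := by
  obtain ⟨i, k, hconj⟩ := hu
  obtain ⟨c, rfl⟩ := isConj_iff.1 hconj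
  have hk : ¬ (e i : ℤ) ∣ k := by
    intro hk
    rw [of_zpow_eq_one hk, mul_one, mul_inv_cancel] at hu1
    exact hu1 rfl
  refine ⟨c * PresentedGroup.of i * c⁻¹, ⟨i, 1, isConj_iff.2 ⟨c, by rw [zpow_one]⟩⟩, fun g hg => ?_⟩
  have hg' := hg.map (MulAut.conj c⁻¹)
  have hcancel : MulAut.conj c⁻¹ (c * PresentedGroup.of i ^ k * c⁻¹) = PresentedGroup.of i ^ k := by
    rw [MulAut.conj_apply]
    group
  rw [hcancel] at hg'
  obtain ⟨m, hm⟩ := mem_zpowers_of_commute_of_zpow hk hg'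
  refine ⟨m, ?_⟩
  simp only [MulAut.conj_apply] at hm ⊢
  rw [conj_zpow, hm]
  group

theorem IsElliptic.of_commute {g u : CyclicFreeProduct e} (hg1 : g ≠ 1) (hg : IsElliptic g)
    (h : Commute u g) : IsElliptic u := by
  obtain ⟨z, hz, hcent⟩ := hg.exists_forall_commute_mem_zpowers hg1
  obtain ⟨m, rfl⟩ := hcent u h
  exact hz.zpow m

theorem isCyclic_centralizer {u : CyclicFreeProduct e} (hu1 : u ≠ 1) :
    IsCyclic (Subgroup.centralizer {u}) := by
  by_cases hu : IsElliptic u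
  · obtain ⟨z, -, hz⟩ := hu.exists_forall_commute_mem_zpowers hu1
    exact Subgroup.isCyclic_of_le fun g hg => hz g (Subgroup.mem_centralizer_singleton_iff.1 hg)
  obtain ⟨x, l, hx, hl⟩ := exists_injective_isPrimitiveRoot e
  have hcomm (g : Subgroup.centralizer {u}) : Commute g.1 u :=
    Subgroup.mem_centralizer_singleton_iff.1 g.2
  have hpos : ∀ g : Subgroup.centralizer {u}, g ≠ 1 →
      0 < (traceSq (polyRep x l hl g.1)).natDegree := by
    intro g hg
    have hg1 : g.1 ≠ 1 := fun h => hg (Subtype.ext h)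
    exact natDegree_traceSq_polyRep_pos hl hx hg1 fun hell =>
      hu (hell.of_commute hg1 (hcomm g).symm)
  refine isCyclic_of_euclidean_descent (fun g => (traceSq (polyRep x l hl g.1)).natDegree)
    fun g h _ hh hle => ?_
  have hdesc := natDegree_traceSq_mul_lt_or ((hcomm g).map (polyRep x l hl))
    ((hcomm h).map (polyRep x l hl)) (natDegree_traceSq_polyRep_pos hl hx hu1 hu) (hpos h hh) hle
  rwa [← map_inv, ← map_mul, ← map_mul] at hdesc

theorem mem_zpowers_of_not_isProperPower {H : Type*} [Group H] {u z : H} (hu : ¬ IsProperPower u)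
    (h : u ∈ Subgroup.zpowers z) : z ∈ Subgroup.zpowers u := by
  obtain ⟨k, rfl : z ^ k = u⟩ := h
  have hk2 : k.natAbs < 2 := by
    by_contra! hk2
    rcases Int.natAbs_eq k with h | h
    · exact hu ⟨z, k.natAbs, hk2, by conv_rhs => rw [h, zpow_natCast]⟩
    · exact hu ⟨z⁻¹, k.natAbs, hk2, by conv_rhs => rw [h, zpow_neg, zpow_natCast, ← inv_pow]⟩
  have hk0 : k ≠ 0 := by
    rintro rfl
    exact hu ⟨1, 2, le_rfl, by rw [one_pow, zpow_zero]⟩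
  obtain rfl | rfl : k = 1 ∨ k = -1 := by omega
  · simp
  · simp

theorem mem_zpowers_of_commute {u g : CyclicFreeProduct e} (hu : ¬ IsProperPower u)
    (hg : Commute g u) : g ∈ Subgroup.zpowers u := by
  have hu1 : u ≠ 1 := by
    rintro rfl
    exact hu ⟨1, 2, le_rfl, one_pow 2⟩
  obtain ⟨z, hz⟩ := (Subgroup.isCyclic_iff_exists_zpowers_eq_top _).1 (isCyclic_centralizer hu1)
  have hmem {h : CyclicFreeProduct e} (hh : Commute h u) : h ∈ Subgroup.zpowers z :=
    hz ▸ Subgroup.mem_centralizer_singleton_iff.2 hh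
  have hz : z ∈ Subgroup.zpowers u := mem_zpowers_of_not_isProperPower hu (hmem (Commute.refl u))
  exact Subgroup.zpowers_le.2 hz (hmem hg)

end Centralizers

section Diagonalization

variable {K : Type*} [Field K]

/-- The diagonal torus `u ↦ diag(u, u⁻¹)` of `SL(2, K)`. -/
def diagTorus : Kˣ →* SL(2, K) :=
  splitTorus !![1, 0; 0, 0] (by simp [Matrix.trace_fin_two]) (by simp)

theorem coe_diagTorus (u : Kˣ) : (diagTorus u).1 = !![(u : K), 0; 0, ↑u⁻¹] := by
  rw [diagTorus, coe_splitTorus]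
  ext i j
  fin_cases i <;> fin_cases j <;> simp

theorem exists_mul_eq_diag_mul {P : Matrix (Fin 2) (Fin 2) K} (ht : P.trace = 1) (hd : P.det = 0) :
    ∃ S : SL(2, K), S.1 * P = !![1, 0; 0, 0] * S.1 := by
  rw [Matrix.trace_fin_two] at ht
  rw [Matrix.det_fin_two] at hd
  by_cases h00 : P 0 0 = 0
  · have h11 : P 1 1 = 1 := by simpa [h00] using ht
    have h10 : P 1 0 * P 0 1 = 0 := by linear_combination P 1 1 * h00 - hd
    refine ⟨⟨!![P 1 0, 1; -1, P 0 1], by rw [Matrix.det_fin_two_of]; linear_combination h10⟩, ?_⟩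
    ext i j
    fin_cases i <;> fin_cases j <;>
      simp [Matrix.mul_apply, h00, h11, mul_eq_zero.1 h10, (mul_eq_zero.1 h10).symm]
  · refine ⟨⟨!![1, P 0 1 / P 0 0; -P 1 0, P 0 0], ?_⟩, ?_⟩
    · rw [Matrix.det_fin_two_of]
      field_simp
      linear_combination P 0 0 * ht - hd
    · ext i j
      fin_cases i <;> fin_cases j <;> simp [Matrix.mul_apply] <;> field_simp
      · linear_combination P 0 0 * ht - hd
      · linear_combination P 0 1 * ht
      · ring
      · linear_combination hd

theorem exists_eq_splitTorus {M : SL(2, K)} {z : Kˣ} (hz : (z - ↑z⁻¹ : K) ≠ 0)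
    (hM : M.1.trace = z + ↑z⁻¹) : ∃ P ht hd, M = splitTorus P ht hd z := by
  have hdet := M.det_coe
  have hzz := z.mul_inv
  rw [Matrix.det_fin_two] at hdet
  rw [Matrix.trace_fin_two] at hM
  refine ⟨(z - ↑z⁻¹ : K)⁻¹ • (M.1 - (↑z⁻¹ : K) • 1), ?_, ?_, Subtype.ext ?_⟩
  · rw [Matrix.trace_smul, smul_eq_mul, inv_mul_eq_one₀ hz, Matrix.trace_sub, Matrix.trace_smul,
      Matrix.trace_one, Matrix.trace_fin_two, Fintype.card_fin, smul_eq_mul]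
    rw [Nat.cast_ofNat]
    linear_combination -hM
  · rw [Matrix.det_smul, Matrix.det_fin_two]
    refine mul_eq_zero_of_right _ ?_
    simp only [Matrix.sub_apply, Matrix.smul_apply, Matrix.one_apply_eq,
      Matrix.one_apply_ne zero_ne_one, Matrix.one_apply_ne one_ne_zero, smul_eq_mul]
    linear_combination hdet - (↑z⁻¹ : K) * hM - hzz
  · rw [coe_splitTorus, smul_sub (_ : K) 1, add_sub_left_comm, ← sub_smul, smul_smul,
      mul_inv_cancel₀ hz, one_smul, add_sub_cancel]

theorem isConj_diagTorus {g : PSL(2, K)} {z : Kˣ} (hg : traceSq g ≠ 4)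
    (hz : (z + ↑z⁻¹ : K) ^ 2 = traceSq g) : IsConj g (diagTorus z : SL(2, K)) := by
  have hz0 : (z - ↑z⁻¹ : K) ≠ 0 := by
    contrapose! hg
    linear_combination -hz + (z - ↑z⁻¹ : K) * hg + 4 * z.mul_inv
  obtain ⟨M, rfl, hM⟩ : ∃ M : SL(2, K), (M : PSL(2, K)) = g ∧ M.1.trace = z + ↑z⁻¹ := by
    induction g using QuotientGroup.induction_on with | _ M
    rcases sq_eq_sq_iff_eq_or_eq_neg.1 hz with h | h
    · exact ⟨M, rfl, h.symm⟩
    · exact ⟨-M, psl_mk_eq_mk_iff.2 (Or.inr (neg_neg M).symm),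
        by rw [Matrix.SpecialLinearGroup.coe_neg, Matrix.trace_neg, h]⟩
  obtain ⟨P, ht, hd, rfl⟩ := exists_eq_splitTorus hz0 hM
  obtain ⟨S, hS⟩ := exists_mul_eq_diag_mul ht hd
  refine (QuotientGroup.mk' _).map_isConj (isConj_iff.2 ⟨S, mul_inv_eq_iff_eq_mul.2 ?_⟩)
  refine Subtype.ext ?_
  rw [Matrix.SpecialLinearGroup.coe_mul, Matrix.SpecialLinearGroup.coe_mul, coe_splitTorus,
    diagTorus, coe_splitTorus]
  simp only [mul_add, add_mul, mul_sub, sub_mul, Matrix.mul_smul, Matrix.smul_mul, hS, mul_one,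
    one_mul]

variable {H : Type*} [Group H] {σ : H →* PSL(2, K)} {u : H}

theorem IsUnipotentFree.exists_conj_apply_eq_diagTorus (hσ : IsUnipotentFree σ) (hu : u ≠ 1)
    {z : Kˣ} (hz : (z + ↑z⁻¹ : K) ^ 2 = traceSq (σ u)) :
    ∃ σ' : H →* PSL(2, K), IsUnipotentFree σ' ∧ σ' u = (diagTorus z : SL(2, K)) := by
  obtain ⟨c, hc⟩ := isConj_iff.1 (isConj_diagTorus (hσ u hu) hz)
  exact ⟨_, hσ.conj_comp c, hc⟩

theorem trace_commutator_diagTorus {M : SL(2, K)} (hM : M.1 0 1 * M.1 1 0 = 0) (z : Kˣ) :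
    (M * diagTorus z * M⁻¹ * (diagTorus z)⁻¹).1.trace = 2 := by
  have hd := M.det_coe
  have hzz := z.mul_inv
  rw [Matrix.det_fin_two] at hd
  rw [← map_inv]
  simp only [Matrix.SpecialLinearGroup.coe_mul, coe_diagTorus, Matrix.SpecialLinearGroup.coe_inv,
    Matrix.adjugate_fin_two, Matrix.trace_fin_two, Matrix.mul_apply, Fin.sum_univ_two, inv_inv]
  simp only [Matrix.of_apply, Matrix.cons_val', Matrix.cons_val_zero, Matrix.cons_val_one,
    Matrix.cons_val_fin_one]
  linear_combination 2 * hd + 2 * M.1 0 0 * M.1 1 1 * hzz + (2 - (z : K) ^ 2 - (↑z⁻¹ : K) ^ 2) * hM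

theorem IsUnipotentFree.apply_ne_zero_of_not_commute (hσ : IsUnipotentFree σ) {z : Kˣ}
    (hu : σ u = (diagTorus z : SL(2, K))) {g : H} (hg : ¬ Commute g u) {M : SL(2, K)}
    (hM : (M : PSL(2, K)) = σ g) : M.1 0 1 ≠ 0 ∧ M.1 1 0 ≠ 0 := by
  rw [← mul_ne_zero_iff]
  intro h0
  refine hσ (g * u * g⁻¹ * u⁻¹) (fun h => hg ?_) ?_
  · rwa [mul_inv_eq_one, mul_inv_eq_iff_eq_mul] at h
  · simp only [map_mul, map_inv, hu, ← hM, ← QuotientGroup.mk_inv, ← QuotientGroup.mk_mul,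
      traceSq_mk, trace_commutator_diagTorus h0]
    norm_num

end Diagonalization

section OneRelatorProducts

open Monoid.Coprod (inl inr)

variable {A B G K : Type*} [Group A] [Group B] [Group G] [Group K]

/-- `G` is, through `i₁` and `i₂`, the quotient of the free product `A ∗ B` by the normal closure of
the single relator `a * b`; when `a` and `b` have the same order, this is the amalgamated product of
`A` and `B` along `a = b⁻¹`. -/
structure IsOneRelatorProduct (i₁ : A →* G) (i₂ : B →* G) (a : A) (b : B) : Prop where
  surjective : Function.Surjective (Monoid.Coprod.lift i₁ i₂)
  ker_eq : (Monoid.Coprod.lift i₁ i₂).ker = Subgroup.normalClosure {inl a * inr b}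

variable {i₁ : A →* G} {i₂ : B →* G} {a : A} {b : B}

namespace IsOneRelatorProduct

theorem mul_eq_one (h : IsOneRelatorProduct i₁ i₂ a b) : i₁ a * i₂ b = 1 := by
  have hmem : (inl a * inr b : Monoid.Coprod A B) ∈ (Monoid.Coprod.lift i₁ i₂).ker :=
    h.ker_eq ▸ Subgroup.subset_normalClosure rfl
  simpa only [MonoidHom.mem_ker, map_mul, Monoid.Coprod.lift_apply_inl,
    Monoid.Coprod.lift_apply_inr] using hmem

theorem exists_lift (h : IsOneRelatorProduct i₁ i₂ a b) {φ₁ : A →* K} {φ₂ : B →* K}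
    (hφ : φ₁ a * φ₂ b = 1) : ∃ φ : G →* K, φ.comp i₁ = φ₁ ∧ φ.comp i₂ = φ₂ := by
  have hker : (Monoid.Coprod.lift i₁ i₂).ker ≤ (Monoid.Coprod.lift φ₁ φ₂).ker := by
    rw [h.ker_eq]
    refine Subgroup.normalClosure_le_normal (Set.singleton_subset_iff.2 ?_)
    simpa only [SetLike.mem_coe, MonoidHom.mem_ker, map_mul, Monoid.Coprod.lift_apply_inl,
      Monoid.Coprod.lift_apply_inr] using hφ
  let φ := (Monoid.Coprod.lift i₁ i₂).liftOfSurjective h.surjective ⟨_, hker⟩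
  have hlift : φ.comp (Monoid.Coprod.lift i₁ i₂) = Monoid.Coprod.lift φ₁ φ₂ :=
    MonoidHom.liftOfRightInverse_comp ..
  refine ⟨φ, ?_, ?_⟩
  · rw [← Monoid.Coprod.lift_comp_inl i₁ i₂, ← MonoidHom.comp_assoc, hlift,
      Monoid.Coprod.lift_comp_inl]
  · rw [← Monoid.Coprod.lift_comp_inr i₁ i₂, ← MonoidHom.comp_assoc, hlift,
      Monoid.Coprod.lift_comp_inr]

theorem comp_mulEquiv (h : IsOneRelatorProduct i₁ i₂ a b) (φ : G ≃* K) :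
    IsOneRelatorProduct (φ.toMonoidHom.comp i₁) (φ.toMonoidHom.comp i₂) a b where
  surjective := by
    rw [← Monoid.Coprod.comp_lift]
    exact φ.surjective.comp h.surjective
  ker_eq := by
    rw [← Monoid.Coprod.comp_lift, ← h.ker_eq]
    exact MonoidHom.ker_mulEquiv_comp _ φ

theorem map_zpowers_left_le (h : IsOneRelatorProduct i₁ i₂ a b) :
    (Subgroup.zpowers a).map i₁ ≤ i₂.range := by
  rw [MonoidHom.map_zpowers, Subgroup.zpowers_le, eq_inv_of_mul_eq_one_left h.mul_eq_one]
  exact ⟨b⁻¹, map_inv i₂ b⟩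

theorem map_zpowers_right_le (h : IsOneRelatorProduct i₁ i₂ a b) :
    (Subgroup.zpowers b).map i₂ ≤ i₁.range := by
  rw [MonoidHom.map_zpowers, Subgroup.zpowers_le, eq_inv_of_mul_eq_one_right h.mul_eq_one]
  exact ⟨a⁻¹, map_inv i₁ a⟩

end IsOneRelatorProduct

namespace FTypePresentation

variable (P : FTypePresentation)

theorem incl₁_mul_incl₂_eq_one : P.incl₁ (wordElt P.e P.U) * P.incl₂ (wordElt P.f P.V) = 1 :=
  PresentedGroup.one_of_mem (Or.inr rfl)

theorem exists_lift {φ₁ : P.G₁ →* K} {φ₂ : P.G₂ →* K}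
    (hφ : φ₁ (wordElt P.e P.U) * φ₂ (wordElt P.f P.V) = 1) :
    ∃ φ : P.Grp →* K, φ.comp P.incl₁ = φ₁ ∧ φ.comp P.incl₂ = φ₂ := by
  let φ : FreeGroup (Fin P.p ⊕ Fin P.q) →* K := FreeGroup.lift
    (Sum.elim (fun i => φ₁ (PresentedGroup.of i)) fun j => φ₂ (PresentedGroup.of j))
  have hφ₁ : φ.comp (FreeGroup.map Sum.inl) = φ₁.comp (PresentedGroup.mk _) := by
    ext i
    simp [φ, PresentedGroup.of]
  have hφ₂ : φ.comp (FreeGroup.map Sum.inr) = φ₂.comp (PresentedGroup.mk _) := by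
    ext j
    simp [φ, PresentedGroup.of]
  have hrels : ∀ r ∈ P.rels, φ r = 1 := by
    rintro r (⟨i | j, rfl⟩ | rfl)
    · have hpow : (PresentedGroup.of i : CyclicFreeProduct P.e) ^ P.e i = 1 :=
        PresentedGroup.one_of_mem (Set.mem_range_self i)
      simpa [φ] using congrArg φ₁ hpow
    · have hpow : (PresentedGroup.of j : CyclicFreeProduct P.f) ^ P.f j = 1 :=
        PresentedGroup.one_of_mem (Set.mem_range_self j)
      simpa [φ] using congrArg φ₂ hpow
    · rw [map_mul, ← MonoidHom.comp_apply, hφ₁, ← MonoidHom.comp_apply φ, hφ₂]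
      exact hφ
  refine ⟨PresentedGroup.toGroup hrels, ?_, ?_⟩
  · ext i
    exact DFunLike.congr_fun hφ₁ (FreeGroup.of i)
  · ext j
    exact DFunLike.congr_fun hφ₂ (FreeGroup.of j)

theorem isOneRelatorProduct :
    IsOneRelatorProduct P.incl₁ P.incl₂ (wordElt P.e P.U) (wordElt P.f P.V) where
  surjective := by
    rw [← MonoidHom.range_eq_top, eq_top_iff, ← PresentedGroup.closure_range_of,
      Subgroup.closure_le]
    rintro _ ⟨i | j, rfl⟩
    · exact ⟨inl (PresentedGroup.of i), rfl⟩
    · exact ⟨inr (PresentedGroup.of j), rfl⟩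
  ker_eq := by
    set N : Subgroup (Monoid.Coprod P.G₁ P.G₂) :=
      Subgroup.normalClosure {inl (wordElt P.e P.U) * inr (wordElt P.f P.V)}
    refine le_antisymm (fun x hx => ?_)
      (Subgroup.normalClosure_le_normal (Set.singleton_subset_iff.2 P.incl₁_mul_incl₂_eq_one))
    obtain ⟨φ, hφ₁, hφ₂⟩ := P.exists_lift (φ₁ := (QuotientGroup.mk' N).comp inl)
      (φ₂ := (QuotientGroup.mk' N).comp inr)
      ((QuotientGroup.eq_one_iff _).2 (Subgroup.subset_normalClosure rfl))
    have hφ : φ.comp (Monoid.Coprod.lift P.incl₁ P.incl₂) = QuotientGroup.mk' N :=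
      Monoid.Coprod.hom_ext
        (by rw [MonoidHom.comp_assoc, Monoid.Coprod.lift_comp_inl, hφ₁])
        (by rw [MonoidHom.comp_assoc, Monoid.Coprod.lift_comp_inr, hφ₂])
    rw [← QuotientGroup.ker_mk' N, MonoidHom.mem_ker, ← hφ, MonoidHom.comp_apply,
      MonoidHom.mem_ker.1 hx, map_one]

end FTypePresentation

end OneRelatorProducts

section AlternatingProducts

variable {A B G K : Type*} [Group A] [Group B] [Group G] [Group K] {i₁ : A →* G} {i₂ : B →* G}

/-- The alternating product `i₁ a₁ * i₂ b₁ * ⋯ * i₁ aₙ * i₂ bₙ` given by a list of pairs of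
syllables `(aⱼ, bⱼ)`. -/
def pairProd (i₁ : A →* G) (i₂ : B →* G) (w : List (A × B)) : G :=
  (w.map fun s => i₁ s.1 * i₂ s.2).prod

@[simp] theorem pairProd_nil : pairProd i₁ i₂ [] = 1 := rfl

@[simp] theorem pairProd_cons (s : A × B) (w : List (A × B)) :
    pairProd i₁ i₂ (s :: w) = i₁ s.1 * i₂ s.2 * pairProd i₁ i₂ w :=
  List.prod_cons

@[simp] theorem pairProd_append (v w : List (A × B)) :
    pairProd i₁ i₂ (v ++ w) = pairProd i₁ i₂ v * pairProd i₁ i₂ w := by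
  rw [pairProd, List.map_append, List.prod_append, pairProd, pairProd]

theorem map_pairProd (φ : G →* K) (w : List (A × B)) :
    φ (pairProd i₁ i₂ w) = pairProd (φ.comp i₁) (φ.comp i₂) w := by
  simp only [pairProd, map_list_prod, List.map_map, Function.comp_def, map_mul,
    MonoidHom.comp_apply]

theorem exists_pairProd_eq (h : Function.Surjective (Monoid.Coprod.lift i₁ i₂)) (x : G) :
    ∃ w, pairProd i₁ i₂ w = x := by
  obtain ⟨y, rfl⟩ := h x
  induction y using Monoid.Coprod.induction_on with
  | inl a => exact ⟨[(a, 1)], by simp⟩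
  | inr b => exact ⟨[(1, b)], by simp⟩
  | mul y z ihy ihz =>
    obtain ⟨v, hv⟩ := ihy
    obtain ⟨w, hw⟩ := ihz
    exact ⟨v ++ w, by rw [pairProd_append, hv, hw, map_mul]⟩

theorem isConj_pairProd_append_comm (v w : List (A × B)) :
    IsConj (pairProd i₁ i₂ (v ++ w)) (pairProd i₁ i₂ (w ++ v)) :=
  isConj_iff.2 ⟨pairProd i₁ i₂ w, by simp [mul_assoc]⟩

theorem exists_isConj_pairProd_cons_of_left_mem {a : A} (ha : i₁ a ∈ i₂.range) (b : B)
    (w : List (A × B)) : (∃ b', IsConj (i₂ b') (pairProd i₁ i₂ ((a, b) :: w))) ∨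
      ∃ v, v.length = w.length ∧ IsConj (pairProd i₁ i₂ v) (pairProd i₁ i₂ ((a, b) :: w)) := by
  obtain ⟨c, hc⟩ := ha
  rcases w.eq_nil_or_concat with rfl | ⟨w, s, rfl⟩
  · exact Or.inl ⟨c * b, by rw [map_mul, hc, pairProd_cons, pairProd_nil, mul_one]⟩
  · refine Or.inr ⟨w ++ [(s.1, s.2 * c * b)], by simp, isConj_iff.2 ⟨i₂ (c * b), ?_⟩⟩
    simp [← hc, mul_assoc]

theorem exists_isConj_pairProd_cons_of_right_mem (a : A) {b : B} (hb : i₂ b ∈ i₁.range)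
    (w : List (A × B)) : (∃ a', IsConj (i₁ a') (pairProd i₁ i₂ ((a, b) :: w))) ∨
      ∃ v, v.length = w.length ∧ IsConj (pairProd i₁ i₂ v) (pairProd i₁ i₂ ((a, b) :: w)) := by
  obtain ⟨c, hc⟩ := hb
  rcases w with _ | ⟨s, w⟩
  · exact Or.inl ⟨a * c, by rw [map_mul, hc, pairProd_cons, pairProd_nil, mul_one]⟩
  · refine Or.inr ⟨(a * c * s.1, s.2) :: w, rfl, ?_⟩
    simp only [pairProd_cons, map_mul, hc, mul_assoc, IsConj.refl]

variable {C₁ : Subgroup A} {C₂ : Subgroup B}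

theorem exists_isConj_pairProd_of_mem (hC₁ : C₁.map i₁ ≤ i₂.range) (hC₂ : C₂.map i₂ ≤ i₁.range)
    {w : List (A × B)} {s : A × B} (hsw : s ∈ w) (hs : s.1 ∈ C₁ ∨ s.2 ∈ C₂) :
    (∃ a, IsConj (i₁ a) (pairProd i₁ i₂ w)) ∨ (∃ b, IsConj (i₂ b) (pairProd i₁ i₂ w)) ∨
      ∃ v, v.length < w.length ∧ IsConj (pairProd i₁ i₂ v) (pairProd i₁ i₂ w) := by
  obtain ⟨l, r, rfl⟩ := List.append_of_mem hsw
  have hrot : IsConj (pairProd i₁ i₂ (s :: (r ++ l))) (pairProd i₁ i₂ (l ++ s :: r)) :=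
    isConj_pairProd_append_comm (s :: r) l
  have hlen : (r ++ l).length < (l ++ s :: r).length := by grind
  rcases hs with ha | hb
  · rcases exists_isConj_pairProd_cons_of_left_mem (hC₁ (Subgroup.mem_map_of_mem i₁ ha)) s.2
      (r ++ l) with ⟨b, hb⟩ | ⟨v, hv, hvw⟩
    · exact Or.inr (Or.inl ⟨b, hb.trans hrot⟩)
    · exact Or.inr (Or.inr ⟨v, hv ▸ hlen, hvw.trans hrot⟩)
  · rcases exists_isConj_pairProd_cons_of_right_mem s.1 (hC₂ (Subgroup.mem_map_of_mem i₂ hb))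
      (r ++ l) with ⟨a, ha⟩ | ⟨v, hv, hvw⟩
    · exact Or.inl ⟨a, ha.trans hrot⟩
    · exact Or.inr (Or.inr ⟨v, hv ▸ hlen, hvw.trans hrot⟩)

theorem exists_isConj_of_surjective_lift (h : Function.Surjective (Monoid.Coprod.lift i₁ i₂))
    (hC₁ : C₁.map i₁ ≤ i₂.range) (hC₂ : C₂.map i₂ ≤ i₁.range) (x : G) :
    (∃ a, IsConj (i₁ a) x) ∨ (∃ b, IsConj (i₂ b) x) ∨
      ∃ w ≠ [], (∀ s ∈ w, s.1 ∉ C₁ ∧ s.2 ∉ C₂) ∧ IsConj (pairProd i₁ i₂ w) x := by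
  obtain ⟨w, hwx⟩ := exists_pairProd_eq h x
  induction hn : w.length using Nat.strong_induction_on generalizing w x with | _ n ih
  subst hwx hn
  rcases eq_or_ne w [] with rfl | hw
  · exact Or.inl ⟨1, by rw [map_one, pairProd_nil]⟩
  by_cases hgood : ∀ s ∈ w, s.1 ∉ C₁ ∧ s.2 ∉ C₂
  · exact Or.inr (Or.inr ⟨w, hw, hgood, IsConj.refl _⟩)
  · simp only [not_forall, not_and_or, not_not] at hgood
    obtain ⟨s, hsw, hs⟩ := hgood
    rcases exists_isConj_pairProd_of_mem hC₁ hC₂ hsw hs with ha | hb | ⟨v, hv, hvw⟩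
    · exact Or.inl ha
    · exact Or.inr (Or.inl hb)
    · exact (ih _ hv _ v rfl rfl).imp (fun ⟨a, ha⟩ => ⟨a, ha.trans hvw⟩) <|
        Or.imp (fun ⟨b, hb⟩ => ⟨b, hb.trans hvw⟩)
          fun ⟨t, ht, htC, htv⟩ => ⟨t, ht, htC, htv.trans hvw⟩

end AlternatingProducts

section GenericConjugation

variable {K : Type*} [Field K]

/-- The polynomial matrix whose value at `s ^ 2` is `s ^ 2 • (diag(s, s⁻¹) N diag(s, s⁻¹)⁻¹)`. -/
noncomputable def twist (N : Matrix (Fin 2) (Fin 2) K) : Matrix (Fin 2) (Fin 2) K[X] :=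
  ((X : K[X]) • (!![1, 0; 0, 0] : Matrix _ _ K).map C + (!![0, 0; 0, 1] : Matrix _ _ K).map C) *
    N.map C *
  ((X : K[X]) • (!![0, 0; 0, 1] : Matrix _ _ K).map C + (!![1, 0; 0, 0] : Matrix _ _ K).map C)

theorem hasLead_map_C (M : Matrix (Fin 2) (Fin 2) K) : HasLead (M.map C) 0 M := fun _ _ =>
  ⟨(natDegree_C _).le, coeff_C_zero⟩

theorem hasLead_twist (N : Matrix (Fin 2) (Fin 2) K) :
    HasLead (twist N) 2 !![0, N 0 1; 0, 0] := by
  have hlead : !![1, 0; 0, 0] * N * !![0, 0; 0, 1] = !![0, N 0 1; 0, 0] := by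
    rw [Matrix.eta_fin_two N]
    ext i j
    fin_cases i <;> fin_cases j <;> simp
  exact hlead ▸ ((hasLead_X_smul_map_add _ _).mul (hasLead_map_C N)).mul
    (hasLead_X_smul_map_add _ _)

theorem map_eval_twist (N : SL(2, K)) (s : Kˣ) :
    (twist N.1).map (evalRingHom ((s : K) ^ 2)) =
      (s : K) ^ 2 • (diagTorus s * N * (diagTorus s)⁻¹).1 := by
  rw [← map_inv]
  ext i j
  fin_cases i <;> fin_cases j <;>
    simp only [twist, coe_diagTorus, Matrix.SpecialLinearGroup.coe_mul, Matrix.mul_apply,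
      Fin.sum_univ_two, Matrix.map_apply, Matrix.smul_apply, inv_inv] <;>
    simp <;> field_simp

/-- The polynomial matrix which interpolates, up to a scalar, the alternating products of `w` with
second syllables conjugated by diagonal matrices. -/
noncomputable def twistProd (w : List (SL(2, K) × SL(2, K))) : Matrix (Fin 2) (Fin 2) K[X] :=
  (w.map fun g => g.1.1.map C * twist g.2.1).prod

theorem twistProd_cons (g : SL(2, K) × SL(2, K)) (w : List (SL(2, K) × SL(2, K))) :
    twistProd (g :: w) = g.1.1.map C * twist g.2.1 * twistProd w :=
  List.prod_cons

theorem map_eval_twistProd (w : List (SL(2, K) × SL(2, K))) (s : Kˣ) :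
    (twistProd w).map (evalRingHom ((s : K) ^ 2)) = ((s : K) ^ 2) ^ w.length •
      (pairProd (MonoidHom.id _) (MulAut.conj (diagTorus s)).toMonoidHom w).1 := by
  induction w with
  | nil => simp [twistProd, Matrix.map_one]
  | cons g w ih =>
    have hC : (g.1.1.map C).map (evalRingHom ((s : K) ^ 2)) = g.1.1 := by
      ext i j
      simp
    rw [twistProd_cons, Matrix.map_mul, Matrix.map_mul, ih, map_eval_twist, hC, pairProd_cons,
      Matrix.SpecialLinearGroup.coe_mul, Matrix.SpecialLinearGroup.coe_mul, List.length_cons,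
      Matrix.mul_smul, Matrix.mul_smul, Matrix.smul_mul, smul_smul, ← pow_succ]
    rfl

theorem exists_hasLead_twistProd {w : List (SL(2, K) × SL(2, K))}
    (hw : ∀ g ∈ w, g.1.1 1 0 ≠ 0 ∧ g.2.1 0 1 ≠ 0) :
    ∃ L, L 1 0 = 0 ∧ L 1 1 ≠ 0 ∧ HasLead (twistProd w) (2 * w.length) L := by
  induction w with
  | nil => exact ⟨1, by simp, by simp, by simpa [twistProd] using hasLead_map_C (1 : Matrix _ _ K)⟩
  | cons g w ih =>
    rw [List.forall_mem_cons] at hw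
    obtain ⟨L, h10, h11, hL⟩ := ih hw.2
    refine ⟨g.1.1 * !![0, g.2.1 0 1; 0, 0] * L, ?_, ?_, ?_⟩
    · simp [Matrix.mul_apply, h10]
    · simp [Matrix.mul_apply, h11, hw.1]
    · have hlen : 2 * (w.length + 1) = 0 + 2 + 2 * w.length := by ring
      rw [twistProd_cons, List.length_cons, hlen]
      exact ((hasLead_map_C _).mul (hasLead_twist _)).mul hL

theorem finite_setOf_pairProd_mem_center {w : List (SL(2, K) × SL(2, K))} (hne : w ≠ [])
    (hw : ∀ g ∈ w, g.1.1 1 0 ≠ 0 ∧ g.2.1 0 1 ≠ 0) :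
    {s : Kˣ | pairProd (MonoidHom.id _) (MulAut.conj (diagTorus s)).toMonoidHom w ∈
      Subgroup.center SL(2, K)}.Finite := by
  obtain ⟨L, -, h11, hL⟩ := exists_hasLead_twistProd hw
  set p := twistProd w 1 1
  have hdeg : p.natDegree = 2 * w.length :=
    natDegree_eq_of_le_of_coeff_ne_zero (hL 1 1).1 ((hL 1 1).2 ▸ h11)
  have hq : expand K 2 (p ^ 2 - X ^ (2 * w.length)) ≠ 0 := by
    refine (expand_ne_zero zero_lt_two).2 (sub_ne_zero.2 fun h => ?_)
    have hlen := congrArg natDegree h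
    rw [natDegree_pow, natDegree_X_pow, hdeg] at hlen
    have := List.length_pos_iff.2 hne
    omega
  refine .of_finite_image ((finite_setOfPred_isRoot hq).subset ?_) Units.val_injective.injOn
  rintro _ ⟨s, hs, rfl⟩
  have heval : p.eval ((s : K) ^ 2) = ((s : K) ^ 2) ^ w.length *
      (pairProd (MonoidHom.id _) (MulAut.conj (diagTorus s)).toMonoidHom w).1 1 1 :=
    congrFun (congrFun (map_eval_twistProd w s) 1) 1
  rw [Set.mem_ofPred_eq, IsRoot.def, expand_eval, eval_sub, eval_pow, eval_pow, eval_X, heval]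
  rcases mem_center_SL_two_iff.1 hs with h | h <;> rw [h] <;> simp [← pow_mul, mul_comm]

end GenericConjugation

section Embedding

variable {K : Type*} [Field K] {A B G : Type*} [Group A] [Group B] [Group G] {a : A} {b : B}
  {σ₁ : A →* PSL(2, K)} {σ₂ : B →* PSL(2, K)} {z z' : Kˣ}

theorem finite_setOf_pairProd_conj_eq_one (h₁ : IsUnipotentFree σ₁) (h₂ : IsUnipotentFree σ₂)
    (ha : σ₁ a = (diagTorus z : SL(2, K))) (hb : σ₂ b = (diagTorus z' : SL(2, K)))
    {w : List (A × B)} (hne : w ≠ []) (hw : ∀ g ∈ w, ¬ Commute g.1 a ∧ ¬ Commute g.2 b) :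
    {s : Kˣ | pairProd σ₁ ((MulAut.conj (diagTorus s : PSL(2, K))).toMonoidHom.comp σ₂) w =
      1}.Finite := by
  choose m₁ hm₁ using fun g => QuotientGroup.mk_surjective (σ₁ g)
  choose m₂ hm₂ using fun g => QuotientGroup.mk_surjective (σ₂ g)
  have hentries : ∀ g ∈ w.map (Prod.map m₁ m₂), g.1.1 1 0 ≠ 0 ∧ g.2.1 0 1 ≠ 0 := by
    refine List.forall_mem_map.2 fun g hg => ?_
    exact ⟨(h₁.apply_ne_zero_of_not_commute ha (hw g hg).1 (hm₁ _)).2,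
      (h₂.apply_ne_zero_of_not_commute hb (hw g hg).2 (hm₂ _)).1⟩
  refine (finite_setOf_pairProd_mem_center (List.map_eq_nil_iff.not.2 hne) hentries).subset
    fun s hs => (QuotientGroup.eq_one_iff _).1 (Eq.trans ?_ hs)
  rw [← QuotientGroup.mk'_apply, map_pairProd]
  simp only [pairProd, List.map_map, Function.comp_def, Prod.map, MonoidHom.comp_apply, ← hm₁,
    ← hm₂]
  rfl

theorem exists_forall_pairProd_conj_ne_one [Uncountable K] [Countable A] [Countable B]
    (h₁ : IsUnipotentFree σ₁) (h₂ : IsUnipotentFree σ₂)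
    (ha : σ₁ a = (diagTorus z : SL(2, K))) (hb : σ₂ b = (diagTorus z' : SL(2, K))) :
    ∃ s : Kˣ, ∀ w : List (A × B), w ≠ [] → (∀ g ∈ w, ¬ Commute g.1 a ∧ ¬ Commute g.2 b) →
      pairProd σ₁ ((MulAut.conj (diagTorus s : PSL(2, K))).toMonoidHom.comp σ₂) w ≠ 1 := by
  have hbad : (⋃ w : {w : List (A × B) // w ≠ [] ∧ ∀ g ∈ w, ¬ Commute g.1 a ∧ ¬ Commute g.2 b},
      {s : Kˣ | pairProd σ₁ ((MulAut.conj (diagTorus s : PSL(2, K))).toMonoidHom.comp σ₂) w =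
        1}).Countable :=
    Set.countable_iUnion fun w =>
      (finite_setOf_pairProd_conj_eq_one h₁ h₂ ha hb w.2.1 w.2.2).countable
  obtain ⟨t, ht⟩ := exists_notMem_of_countable ((hbad.image Units.val).insert 0)
  rw [Set.mem_insert_iff, not_or] at ht
  exact ⟨Units.mk0 t ht.1, fun w hw hwC h1 =>
    ht.2 ⟨Units.mk0 t ht.1, Set.mem_iUnion.2 ⟨⟨w, hw, hwC⟩, h1⟩, rfl⟩⟩

variable {i₁ : A →* G} {i₂ : B →* G}

theorem IsOneRelatorProduct.exists_injective [Uncountable K] [Countable A] [Countable B]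
    (h : IsOneRelatorProduct i₁ i₂ a b) (ha_centralizer : ∀ g, Commute g a → g ∈ Subgroup.zpowers a)
    (hb_centralizer : ∀ g, Commute g b → g ∈ Subgroup.zpowers b)
    (h₁ : IsUnipotentFree σ₁) (h₂ : IsUnipotentFree σ₂)
    (ha : σ₁ a = (diagTorus z : SL(2, K))) (hb : σ₂ b = (diagTorus z⁻¹ : SL(2, K))) :
    ∃ ρ : G →* PSL(2, K), Function.Injective ρ := by
  obtain ⟨s, hs⟩ := exists_forall_pairProd_conj_ne_one h₁ h₂ ha hb
  set τ := (MulAut.conj (diagTorus s : PSL(2, K))).toMonoidHom.comp σ₂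
  have hτ : σ₁ a * τ b = 1 := by
    change σ₁ a * (_ * σ₂ b * _) = 1
    rw [ha, hb, ← QuotientGroup.mk_inv, ← QuotientGroup.mk_mul, ← QuotientGroup.mk_mul,
      ← QuotientGroup.mk_mul, ← map_inv, ← map_mul, ← map_mul, ← map_mul, mul_inv_cancel_comm,
      mul_inv_cancel, map_one, QuotientGroup.mk_one]
  obtain ⟨ρ, hρ₁, hρ₂⟩ := h.exists_lift hτ
  have eq_one_of_isConj {x y : G} (hxy : IsConj x y) (hx : ρ x = 1 → x = 1) (hy : ρ y = 1) :
      y = 1 := by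
    refine isConj_one_right.1 (hx ?_ ▸ hxy)
    exact isConj_one_left.1 (hy ▸ ρ.map_isConj hxy)
  refine ⟨ρ, (injective_iff_map_eq_one ρ).2 fun x hx => ?_⟩
  rcases exists_isConj_of_surjective_lift h.surjective h.map_zpowers_left_le
    h.map_zpowers_right_le x with ⟨g, hg⟩ | ⟨g, hg⟩ | ⟨w, hw, hwC, hwx⟩
  · refine eq_one_of_isConj hg (fun h1 => ?_) hx
    rw [← MonoidHom.comp_apply, hρ₁] at h1
    rw [(injective_iff_map_eq_one σ₁).1 h₁.injective g h1, map_one]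
  · refine eq_one_of_isConj hg (fun h1 => ?_) hx
    rw [← MonoidHom.comp_apply, hρ₂] at h1
    rw [(injective_iff_map_eq_one τ).1 (h₂.conj_comp _).injective g h1, map_one]
  · refine eq_one_of_isConj hwx (fun h1 => absurd ?_ (hs w hw fun g hg =>
      (hwC g hg).imp (mt (ha_centralizer _)) (mt (hb_centralizer _)))) hx
    rw [← h1, map_pairProd, hρ₁, hρ₂]

variable [IsAlgClosed K] [CharZero K] [Uncountable K] {ι κ : Type} [Countable ι] [Countable κ]
  {e : ι → ℕ} {f : κ → ℕ}

theorem exists_isUnipotentFree_apply_eq_diagTorus {u : CyclicFreeProduct e}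
    {v : CyclicFreeProduct f} (hu : ¬ IsOfFinOrder u) (hv : ¬ IsOfFinOrder v) :
    ∃ (σ₁ : CyclicFreeProduct e →* PSL(2, K)) (σ₂ : CyclicFreeProduct f →* PSL(2, K)) (z : Kˣ),
      IsUnipotentFree σ₁ ∧ IsUnipotentFree σ₂ ∧
      σ₁ u = (diagTorus z : SL(2, K)) ∧ σ₂ v = (diagTorus z⁻¹ : SL(2, K)) := by
  obtain ⟨τ, hτ⟩ := exists_notMem_of_countable
    ((countable_exceptional_traceSq (K := K) hu).union (countable_exceptional_traceSq hv))
  simp only [Set.mem_union, Set.mem_ofPred_eq, not_or, not_forall, not_not] at hτ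
  obtain ⟨⟨σ₁, h₁, hσ₁⟩, σ₂, h₂, hσ₂⟩ := hτ
  obtain ⟨z, hz⟩ := exists_units_add_inv_sq_eq τ
  have hu1 : u ≠ 1 := by rintro rfl; exact hu IsOfFinOrder.one
  have hv1 : v ≠ 1 := by rintro rfl; exact hv IsOfFinOrder.one
  obtain ⟨σ₁', h₁', hσ₁'⟩ := h₁.exists_conj_apply_eq_diagTorus hu1 (hz.trans hσ₁.symm)
  obtain ⟨σ₂', h₂', hσ₂'⟩ := h₂.exists_conj_apply_eq_diagTorus (z := z⁻¹) hv1
    (by rw [inv_inv, add_comm, hz, hσ₂])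
  exact ⟨σ₁', σ₂', z, h₁', h₂', hσ₁', hσ₂'⟩

end Embedding

theorem mainTheorem2_general (K : Type*) [Field K] [IsAlgClosed K] [CharZero K] [Uncountable K]
    {ι κ : Type} [Countable ι] [Countable κ] {e : ι → ℕ} {f : κ → ℕ} {u : CyclicFreeProduct e}
    {v : CyclicFreeProduct f} (hu : ¬ IsOfFinOrder u) (hv : ¬ IsOfFinOrder v)
    {G : Type*} [Group G] {i₁ : CyclicFreeProduct e →* G} {i₂ : CyclicFreeProduct f →* G}
    (h : IsOneRelatorProduct i₁ i₂ u v) :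
    (∃ ρ : G →* PSL(2, K),
      Function.Injective (ρ.comp i₁) ∧ Function.Injective (ρ.comp i₂)) ∧
    (¬ IsProperPower u → ¬ IsProperPower v →
      ∃ ρ : G →* PSL(2, K), Function.Injective ρ) := by
  obtain ⟨σ₁, σ₂, z, h₁, h₂, hσ₁, hσ₂⟩ := exists_isUnipotentFree_apply_eq_diagTorus (K := K) hu hv
  refine ⟨?_, fun hu' hv' => h.exists_injective (fun _ => mem_zpowers_of_commute hu')
    (fun _ => mem_zpowers_of_commute hv') h₁ h₂ hσ₁ hσ₂⟩
  have hmul : σ₁ u * σ₂ v = 1 := by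
    rw [hσ₁, hσ₂, ← QuotientGroup.mk_mul, ← map_mul, mul_inv_cancel, map_one, QuotientGroup.mk_one]
  obtain ⟨ρ, hρ₁, hρ₂⟩ := h.exists_lift hmul
  exact ⟨ρ, hρ₁ ▸ h₁.injective, hρ₂ ▸ h₂.injective⟩

theorem mainTheorem2 (G : Type*) [Group G] (P : FTypePresentation) (φ : P.Grp ≃* G) :
    (∃ ρ : G →* PSL(2, ℂ),
      Function.Injective ((ρ.comp φ.toMonoidHom).comp P.incl₁) ∧
      Function.Injective ((ρ.comp φ.toMonoidHom).comp P.incl₂)) ∧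
    (¬ IsProperPower (wordElt P.e P.U) → ¬ IsProperPower (wordElt P.f P.V) →
      ∃ ρ : G →* PSL(2, ℂ), Function.Injective ρ) :=
  have : Uncountable ℂ := not_countable_iff.1 (Set.countable_univ_iff.not.1 not_countable_complex)
  mainTheorem2_general ℂ P.U_infinite_order P.V_infinite_order
    (P.isOneRelatorProduct.comp_mulEquiv φ)
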